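/- Let $(\Omega,\mathcal F,\mathbb P)$ be a probability space and $\mathcal G\subseteq\mathcal F$ a sub-$\sigma$-algebra such that $(\Omega,\mathcal G,\mathbb P)$ is atomless, i.e. $\{\mathbb P(A): A\subseteq B,\ A\in\mathcal G\}=[0,\mathbb P(B)]$ for all $B\in\mathcal G$. Let $L^\infty$ be the space of essentially bounded random variables (modulo $\mathbb P$-a.s. equality), and $L^\infty(\mathcal G)$ its subset of $\mathcal G$-measurable elements. Let $\mathcal M(\mathcal G)$ (resp. $\mathcal M_1(\mathcal G)$) be the set of finite signed measures (resp. probability measures) on $(\Omega,\mathcal G)$ that are absolutely continuous with respect to $\mathbb P|_{\mathcal G}$. For $\mu\in\mathcal M(\mathcal G)$ let $D_\mu=\mathrm d\mu/\mathrm d\mathbb P|_{\mathcal G}$ and $\mathbb E^\mu[X]=\mathbb E[D_\mu X]$ for $X\in L^\infty$. A mapping $f:L^\infty\to\mathbb R$ is *Fatou* if $f(X)\le\liminf_n f(X_n)$ for every uniformly bounded sequence $(X_n)$ in $L^\infty$ converging $\mathbb P$-a.s. to $X\in L^\infty$. A *coherent risk measure* is a mapping $\rho:L^\infty\to\mathbb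 R$ such that, for all $X,Y\in L^\infty$: $\rho(X+c)=\rho(X)+c$ for $c\in\mathbb R$; $\rho(X)\le\rho(Y)$ if $X\le Y$; $\rho(\lambda X+(1-\lambda)Y)\le\lambda\rho(X)+(1-\lambda)\rho(Y)$ for $\lambda\in[0,1]$; and $\rho(\lambda X)=\lambda\rho(X)$ for $\lambda\ge0$. A mapping $\rho:L^\infty\to\mathbb R$ is *$\mathcal G$-law invariant* if $\rho(X)=\rho(Y)$ for all $X,Y\in L^\infty(\mathcal G)$ with the same distribution under $\mathbb P$. For $\mu\in\mathcal M_1(\mathcal G)$, a *$\mu$-coherent adjustment* is a mapping $\tau:L^\infty\to\mathbb R$ such that, for all $X,Y\in L^\infty$: $\tau(X+Z)=\tau(X)$ for $Z\in L^\infty(\mathcal G)$; $\mathbb E^\mu[X]+\tau(X)\le\mathbb E^\mu[Y]+\tau(Y)$ if $X\le Y$; $\tau(\lambda X+(1-\lambda)Y)\le\lambda\tau(X)+(1-\lambda)\tau(Y)$ for $\lambda\in[0,1]$; and $\tau(\lambda X)=\lambda\tau(X)$ for $\lambda\ge0$. For $\mathcal R\subseteq\mathcal M_1(\mathcal G)$,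 a *CA-assignment* is a family $(\tau_\mu)_{\mu\in\mathcal R}$ such that each $\tau_\mu$ is a Fatou $\mu$-coherent adjustment. Let $w(\mathcal M(\mathcal G),L^\infty(\mathcal G))$ be the coarsest topology on $\mathcal M(\mathcal G)$ making $\mu\mapsto\mathbb E^\mu[X]$ continuous for every $X\in L^\infty(\mathcal G)$. The set $\mathcal R$ is *almost $\mathcal G$-law invariant* if its $w(\mathcal M(\mathcal G),L^\infty(\mathcal G))$-closure $\overline{\mathcal R}$ in $\mathcal M(\mathcal G)$ is $\mathcal G$-law invariant, that is: whenever $\mu\in\overline{\mathcal R}$ and $Y$ is a $\mathcal G$-measurable random variable with the same distribution under $\mathbb P$ as $D_\mu$, then $Y=D_\nu$ $\mathbb P$-a.s. for some $\nu\in\overline{\mathcal R}$. **Theorem.** A mapping $\rho:L^\infty\to\mathbb R$ is a Fatou coherent risk measure if and only if there exist a convex set $\mathcal R\subseteq\mathcal M_1(\mathcal G)$ and a CA-assignment $(\tau_\mu)_{\mu\in\mathcal R}$ such that $$\rho(X)=\sup_{\mu\in\mathcal R}\left(\mathbb E^\mu[X]+\tau_\mu(X)\right),\qquad X\in L^\infty.\tag{$*$}$$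 Moreover, for every convex $\mathcal R\subseteq\mathcal M_1(\mathcal G)$ and every CA-assignment $(\tau_\mu)_{\mu\in\mathcal R}$ for which $(*)$ holds, $\rho$ is $\mathcal G$-law invariant if and only if $\mathcal R$ is almost $\mathcal G$-law invariant. -/

import Mathlib

open MeasureTheory ProbabilityTheory Filter Topology
open scoped ENNReal

namespace PartialLaw

/-- `(Ω, G, P)` is atomless: `{P(A) : A ⊆ B, A ∈ G} = [0, P(B)]` for every `B ∈ G`. -/
def IsAtomless {Ω : Type*} (G : MeasurableSpace Ω) {mΩ : MeasurableSpace Ω} (P : Measure Ω) :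
    Prop :=
  ∀ B : Set Ω, MeasurableSet[G] B →
    {p : ℝ≥0∞ | ∃ A : Set Ω, A ⊆ B ∧ MeasurableSet[G] A ∧ P A = p} = Set.Icc 0 (P B)

/-- The space `L^∞` of essentially bounded random variables, modulo `P`-a.s. equality. -/
abbrev LInf {Ω : Type*} {mΩ : MeasurableSpace Ω} (P : Measure Ω) : Type _ := Lp ℝ ∞ P

/-- The subset `L^∞(G)` of (classes of) `G`-measurable elements of `L^∞`. -/
def LInfSub {Ω : Type*} (G : MeasurableSpace Ω) {mΩ : MeasurableSpace Ω} (P : Measure Ω) :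
    Set (LInf P) :=
  {X | AEStronglyMeasurable[G] X P}

/-! ### Risk measures -/

/-- Fatou continuity. The limit inferior is taken in the extended reals. -/
def IsFatou {Ω : Type*} {mΩ : MeasurableSpace Ω} {P : Measure Ω} (ρ : LInf P → ℝ) : Prop :=
  ∀ (X : ℕ → LInf P) (Y : LInf P),
    (∃ C : ℝ, ∀ n, ‖X n‖ ≤ C) →
    (∀ᵐ ω ∂P, Tendsto (fun n => X n ω) atTop (𝓝 (Y ω))) →
    (ρ Y : EReal) ≤ liminf (fun n => (ρ (X n) : EReal)) atTop

/-- Coherent risk measures on `L^∞` (positive values are losses). -/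
structure IsCoherent {Ω : Type*} {mΩ : MeasurableSpace Ω} {P : Measure Ω} [IsFiniteMeasure P]
    (ρ : LInf P → ℝ) : Prop where
  cash_invariance : ∀ (X : LInf P) (c : ℝ), ρ (X + Lp.const ∞ P c) = ρ X + c
  monotonicity : ∀ X Y : LInf P, X ≤ Y → ρ X ≤ ρ Y
  convexity : ∀ (X Y : LInf P) (l : ℝ), 0 ≤ l → l ≤ 1 →
    ρ (l • X + (1 - l) • Y) ≤ l * ρ X + (1 - l) * ρ Y
  positive_homogeneity : ∀ (X : LInf P) (l : ℝ), 0 ≤ l → ρ (l • X) = l * ρ X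

/-- `G`-law invariance of a mapping on `L^∞`. -/
def IsLawInvariant {Ω : Type*} (G : MeasurableSpace Ω) {mΩ : MeasurableSpace Ω} {P : Measure Ω}
    (ρ : LInf P → ℝ) : Prop :=
  ∀ X ∈ LInfSub G P, ∀ Y ∈ LInfSub G P, IdentDistrib X Y P P → ρ X = ρ Y

/-- `G`-law invariance of a set of random variables `A ⊆ L^0`. -/
def IsLawInvariantSet {Ω : Type*} (G : MeasurableSpace Ω) {mΩ : MeasurableSpace Ω}
    {P : Measure Ω} (A : Set (Ω →ₘ[P] ℝ)) : Prop :=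
  ∀ X ∈ A, AEStronglyMeasurable[G] X P →
    ∀ Y : Ω →ₘ[P] ℝ, AEStronglyMeasurable[G] Y P → IdentDistrib X Y P P → Y ∈ A

/-! ### Absolutely continuous signed measures on the sub-σ-algebra -/

/-- The space `M(G)` of finite signed measures on `(Ω, G)` that are absolutely continuous with
respect to the restriction of `P` to `G`. -/
def acSigned {Ω : Type*} {G mΩ : MeasurableSpace Ω} (P : Measure Ω) (hG : G ≤ mΩ) :
    Submodule ℝ (@SignedMeasure Ω G) where
  carrier := {μ | μ ≪ᵥ (P.trim hG).toENNRealVectorMeasure}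
  zero_mem' := VectorMeasure.AbsolutelyContinuous.zero _
  add_mem' := fun h₁ h₂ => h₁.add h₂
  smul_mem' := fun c _ h => h.smul (r := c)

/-- The set `M_1(G) ⊆ M(G)` of probability measures. -/
def acProb {Ω : Type*} {G mΩ : MeasurableSpace Ω} (P : Measure Ω) (hG : G ≤ mΩ) : Set
    (acSigned P hG) :=
  {μ | (∀ A : Set Ω, MeasurableSet[G] A → 0 ≤ (μ : @SignedMeasure Ω G) A) ∧
    (μ : @SignedMeasure Ω G) Set.univ = 1}

/-- The Radon-Nikodym derivative `D_μ` of `μ ∈ M(G)` with respect to the restriction of `P`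
to `G`. -/
noncomputable def density {Ω : Type*} {G mΩ : MeasurableSpace Ω} {P : Measure Ω} {hG : G ≤ mΩ}
    (μ : acSigned P hG) : Ω → ℝ :=
  SignedMeasure.rnDeriv (μ : @SignedMeasure Ω G) (P.trim hG)

/-- The expectation `E^μ[X] = E[D_μ X]` of `X ∈ L^∞` under `μ ∈ M(G)`. -/
noncomputable def expect {Ω : Type*} {G mΩ : MeasurableSpace Ω} {P : Measure Ω} {hG : G ≤ mΩ}
    (μ : acSigned P hG) (X : LInf P) : ℝ :=
  ∫ ω, density μ ω * X ω ∂P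

/-- The weak topology `w(M(G), L^∞(G))`: the coarsest one for which `μ ↦ E^μ[X]` is continuous
for all `X ∈ L^∞(G)`. -/
@[reducible] noncomputable def weakTopology {Ω : Type*} {G mΩ : MeasurableSpace Ω}
    (P : Measure Ω) (hG : G ≤ mΩ) :
    TopologicalSpace (acSigned P hG) :=
  TopologicalSpace.induced (fun μ (X : LInfSub G P) => expect μ (X : LInf P))
    Pi.topologicalSpace

/-- The set `{D_μ : μ ∈ S} ⊆ L^0` of densities of the elements of `S ⊆ M(G)`. -/
def densitySet {Ω : Type*} {G mΩ : MeasurableSpace Ω} {P : Measure Ω} {hG : G ≤ mΩ}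
    (S : Set (acSigned P hG)) : Set (Ω →ₘ[P] ℝ) :=
  {Z | ∃ μ ∈ S, Z =ᵐ[P] density μ}

/-- A set `S ⊆ M(G)` is almost `G`-law invariant if the set of densities of its
`w(M(G), L^∞(G))`-closure is `G`-law invariant. -/
def IsAlmostLawInvariant {Ω : Type*} {G mΩ : MeasurableSpace Ω} {P : Measure Ω} {hG : G ≤ mΩ}
    (S : Set (acSigned P hG)) : Prop :=
  IsLawInvariantSet G (densitySet (@closure _ (weakTopology P hG) S))

/-! ### Coherent adjustments -/

/-- `μ`-coherent adjustments. -/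
structure IsCoherentAdjustment {Ω : Type*} {G mΩ : MeasurableSpace Ω} {P : Measure Ω} {hG : G ≤ mΩ}
    (μ : acSigned P hG) (τ : LInf P → ℝ) : Prop where
  invariance : ∀ X : LInf P, ∀ Y ∈ LInfSub G P, τ (X + Y) = τ X
  monotonicity : ∀ X Y : LInf P, X ≤ Y → expect μ X + τ X ≤ expect μ Y + τ Y
  convexity : ∀ (X Y : LInf P) (l : ℝ), 0 ≤ l → l ≤ 1 →
    τ (l • X + (1 - l) • Y) ≤ l * τ X + (1 - l) * τ Y
  positive_homogeneity : ∀ (X : LInf P) (l : ℝ), 0 ≤ l → τ (l • X) = l * τ X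

/-- CA-assignments: families, indexed by `R`, of Fatou `μ`-coherent adjustments. -/
def IsCAAssignment {Ω : Type*} {G mΩ : MeasurableSpace Ω} {P : Measure Ω} {hG : G ≤ mΩ}
    (R : Set (acSigned P hG)) (τ : R → LInf P → ℝ) : Prop :=
  ∀ μ : R, IsCoherentAdjustment (μ : acSigned P hG) (τ μ) ∧ IsFatou (τ μ)

/-- `ρ(X) = sup_{μ ∈ R} (E^μ[X] + τ_μ(X))` for all `X ∈ L^∞`, as a genuine supremum in `ℝ`
(in particular `R` is nonempty). -/
def Represents {Ω : Type*} {G mΩ : MeasurableSpace Ω} {P : Measure Ω} {hG : G ≤ mΩ}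
    (R : Set (acSigned P hG)) (τ : R → LInf P → ℝ) (ρ : LInf P → ℝ) : Prop :=
  ∀ X : LInf P,
    IsLUB (Set.range fun μ : R => expect (μ : acSigned P hG) X + τ μ X) (ρ X)

end PartialLaw

/-!
The proof has three ingredients.

*Representation.* A Fatou coherent risk measure `ρ` is the supremum of the expectations
`X ↦ E[Z X]`, with `Z` integrable, that it dominates (`IsCoherent.exists_lt_integral_mul`). This is
Hahn-Banach separation from the acceptance set `{ρ ≤ 0}`, which the Fatou property makes closed
under bounded a.s. convergence; that such a convex set can be separated by an element of `L¹` is a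
form of the Krein-Šmulian theorem (`exists_integrable_separation`). To prove the latter for a
convex set `D` not containing `0`, one chooses constants `c i` one after the other such that
`∑_{i < n} c i * E[(|Y| - i)⁺] > 1` for all `Y ∈ D` with `‖Y‖ ≤ n`. The step from `n` to `n + 1`
is a compactness argument, reduced to completeness of `L²`. The set where all these sums are at
most `1` is a convex neighbourhood of `0` disjoint from `D`, and a functional separating the two is
small on bounded random variables with small `L¹`-norm, so it is given by a density.

*Adjustments.* Grouping the dominated densities `Z` according to the measure `μ` with density
`E[Z | G]` yields `R`, and `τ_μ(X)` is the supremum of `E[Z X] - E^μ[X]` over the group of `μ`. The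
converse implication is a direct verification.

*Law invariance.* Adjustments vanish on `L^∞(G)`, where `ρ` is therefore the support function of
`R`, and of its weak closure. On an atomless space, `E[S W]` can be approximated by `E[T W']` with
`W'` distributed as `W`, whenever `S` and `T` are identically distributed (`exists_rearrangement`).
Rearranging densities shows that the support function of a law invariant closed set is law
invariant. Conversely, a density outside of the closure of a convex set `R` is separated from it by
some `X ∈ L^∞(G)`, and rearranging `X` contradicts the law invariance of the support function.
-/

namespace PartialLaw

/-! ### Preliminaries on `L^∞` -/

section Basic
variable {Ω : Type*} {mΩ : MeasurableSpace Ω} {P : Measure Ω}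

lemma ae_abs_le_norm (X : LInf P) : ∀ᵐ ω ∂P, |X ω| ≤ ‖X‖ := by
  have h := ae_le_eLpNormEssSup (f := X) (μ := P)
  filter_upwards [h] with ω hω
  rw [Lp.norm_def, eLpNorm_exponent_top]
  have hfin : eLpNormEssSup X P ≠ ∞ := by
    have := Lp.eLpNorm_ne_top X
    rwa [eLpNorm_exponent_top] at this
  have := ENNReal.toReal_mono hfin hω
  simpa using this

lemma norm_le_of_ae_abs_le {X : LInf P} {C : ℝ} (hC : 0 ≤ C) (h : ∀ᵐ ω ∂P, |X ω| ≤ C) :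
    ‖X‖ ≤ C := by
  rw [Lp.norm_def, eLpNorm_exponent_top]
  refine ENNReal.toReal_le_of_le_ofReal hC (eLpNormEssSup_le_of_ae_bound ?_)
  simpa using h

lemma exists_LInf_ae_eq {f : Ω → ℝ} (hf : AEStronglyMeasurable f P) {C : ℝ}
    (h : ∀ᵐ ω ∂P, |f ω| ≤ C) : ∃ X : LInf P, X =ᵐ[P] f := by
  have : MemLp f ∞ P := memLp_top_of_bound hf C (by simpa using h)
  exact ⟨this.toLp f, this.coeFn_toLp⟩

lemma integrable_LInf [IsFiniteMeasure P] (X : LInf P) : Integrable X P :=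
  (Lp.memLp X).integrable (by simp)

lemma integrable_mul_LInf {Z : Ω → ℝ} (hZ : Integrable Z P) (X : LInf P) :
    Integrable (fun ω => Z ω * X ω) P :=
  hZ.mul_bdd (c := ‖X‖) (Lp.aestronglyMeasurable X) (by simpa using ae_abs_le_norm X)

lemma integral_mul_add {Z : Ω → ℝ} (hZ : Integrable Z P) (X Y : LInf P) :
    ∫ ω, Z ω * (X + Y) ω ∂P = ∫ ω, Z ω * X ω ∂P + ∫ ω, Z ω * Y ω ∂P := by
  rw [← integral_add (integrable_mul_LInf hZ X) (integrable_mul_LInf hZ Y)]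
  refine integral_congr_ae ?_
  filter_upwards [Lp.coeFn_add X Y] with ω h
  rw [h]; simp [mul_add]

lemma integral_mul_smul {Z : Ω → ℝ} (c : ℝ) (X : LInf P) :
    ∫ ω, Z ω * (c • X) ω ∂P = c * ∫ ω, Z ω * X ω ∂P := by
  rw [← integral_const_mul]
  refine integral_congr_ae ?_
  filter_upwards [Lp.coeFn_smul c X] with ω h
  rw [h]; simp; ring

lemma integral_mul_sub {Z : Ω → ℝ} (hZ : Integrable Z P) (X Y : LInf P) :
    ∫ ω, Z ω * (X - Y) ω ∂P = ∫ ω, Z ω * X ω ∂P - ∫ ω, Z ω * Y ω ∂P := by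
  have := integral_mul_add hZ X ((-1 : ℝ) • Y)
  rw [integral_mul_smul] at this
  rw [show X - Y = X + (-1 : ℝ) • Y by simp [sub_eq_add_neg], this]; ring

lemma integral_mul_const [IsFiniteMeasure P] {Z : Ω → ℝ} (c : ℝ) :
    ∫ ω, Z ω * (Lp.const ∞ P c : LInf P) ω ∂P = c * ∫ ω, Z ω ∂P := by
  rw [← integral_const_mul]
  refine integral_congr_ae ?_
  filter_upwards [Lp.coeFn_const (p := ∞) (μ := P) c] with ω h
  rw [h]; simp [mul_comm]

/-- Dominated convergence for a bounded, a.s. convergent sequence in `L^∞`. -/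
lemma tendsto_integral_mul {Z : Ω → ℝ} (hZ : Integrable Z P) {X : ℕ → LInf P} {Y : LInf P} {C : ℝ}
    (hb : ∀ n, ‖X n‖ ≤ C) (hlim : ∀ᵐ ω ∂P, Tendsto (fun n => X n ω) atTop (𝓝 (Y ω))) :
    Tendsto (fun n => ∫ ω, Z ω * X n ω ∂P) atTop (𝓝 (∫ ω, Z ω * Y ω ∂P)) := by
  refine tendsto_integral_of_dominated_convergence (fun ω => |Z ω| * C)
    (fun n => (integrable_mul_LInf hZ (X n)).aestronglyMeasurable) (hZ.abs.mul_const C) ?_ ?_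
  · intro n
    filter_upwards [ae_abs_le_norm (X n)] with ω h
    rw [norm_mul]
    exact mul_le_mul_of_nonneg_left (h.trans (hb n)) (abs_nonneg _)
  · filter_upwards [hlim] with ω h using h.const_mul _

/-- A set in `L^∞` is boundedly closed if it contains all limits of its norm-bounded,
a.s. convergent sequences. -/
def IsBoundedlyClosed (D : Set (LInf P)) : Prop :=
  ∀ (X : ℕ → LInf P) (Y : LInf P) (C : ℝ), (∀ n, X n ∈ D) → (∀ n, ‖X n‖ ≤ C) →
    (∀ᵐ ω ∂P, Tendsto (fun n => X n ω) atTop (𝓝 (Y ω))) → Y ∈ D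

lemma IsBoundedlyClosed.inter {D E : Set (LInf P)} (hD : IsBoundedlyClosed D)
    (hE : IsBoundedlyClosed E) : IsBoundedlyClosed (D ∩ E) :=
  fun X Y C hX hb hl => ⟨hD X Y C (fun n => (hX n).1) hb hl, hE X Y C (fun n => (hX n).2) hb hl⟩

lemma norm_le_of_tendsto {X : ℕ → LInf P} {Y : LInf P} {C : ℝ} (hb : ∀ n, ‖X n‖ ≤ C)
    (hlim : ∀ᵐ ω ∂P, Tendsto (fun n => X n ω) atTop (𝓝 (Y ω))) : ‖Y‖ ≤ C := by
  refine norm_le_of_ae_abs_le ((norm_nonneg _).trans (hb 0)) ?_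
  filter_upwards [hlim, ae_all_iff.2 fun n => ae_abs_le_norm (X n)] with ω h1 h2
  exact le_of_tendsto h1.abs (Eventually.of_forall fun n => (h2 n).trans (hb n))

end Basic

/-! ### Nested convex sets -/

section Nested

/-- In a real inner product space, almost minimizing sequences of a decreasing sequence of bounded
convex sets are Cauchy. -/
lemma exists_cauchySeq_of_antitone_convex {E : Type*} [NormedAddCommGroup E]
    [InnerProductSpace ℝ E] (S : ℕ → Set E) (hanti : Antitone S) (hconv : ∀ n, Convex ℝ (S n))
    (hne : ∀ n, (S n).Nonempty) {C : ℝ} (hb : ∀ n, ∀ x ∈ S n, ‖x‖ ≤ C) :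
    ∃ x : ℕ → E, (∀ n, x n ∈ S n) ∧ CauchySeq x := by
  set d : ℕ → ℝ := fun n => sInf ((fun x => ‖x‖ ^ 2) '' S n) with hd
  have hbd : ∀ n, BddBelow ((fun x => ‖x‖ ^ 2) '' S n) := fun n =>
    ⟨0, by rintro _ ⟨x, -, rfl⟩; positivity⟩
  have hdle : ∀ n, ∀ x ∈ S n, d n ≤ ‖x‖ ^ 2 := fun n x hx => csInf_le (hbd n) ⟨x, hx, rfl⟩
  have hdmono : Monotone d := fun m n hmn =>
    csInf_le_csInf (hbd m) ((hne n).image _) (Set.image_mono (hanti hmn))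
  have hdb : BddAbove (Set.range d) := by
    refine ⟨C ^ 2, ?_⟩
    rintro _ ⟨n, rfl⟩
    obtain ⟨x, hx⟩ := hne n
    exact (hdle n x hx).trans (pow_le_pow_left₀ (norm_nonneg _) (hb n x hx) 2)
  have hdlim := tendsto_atTop_ciSup hdmono hdb
  set L := ⨆ n, d n
  have hx : ∀ n : ℕ, ∃ x ∈ S n, ‖x‖ ^ 2 < d n + 1 / (n + 1 : ℝ) := by
    intro n
    obtain ⟨_, ⟨x, hx, rfl⟩, h⟩ := exists_lt_of_csInf_lt ((hne n).image (fun x => ‖x‖ ^ 2))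
      (lt_add_of_pos_right (d n) (by positivity : (0 : ℝ) < 1 / (n + 1 : ℝ)))
    exact ⟨x, hx, h⟩
  choose x hxS hxd using hx
  refine ⟨x, hxS, ?_⟩
  -- by the parallelogram identity the distances are controlled by the excess over the infimum
  have hdist : ∀ n k, n ≤ k → ‖x n - x k‖ ^ 2 ≤ 4 * (L - d n) + 4 * (1 / (n + 1 : ℝ)) := by
    intro n k hnk
    have hmid : (1 / 2 : ℝ) • x n + (1 / 2 : ℝ) • x k ∈ S n :=
      hconv n (hxS n) (hanti hnk (hxS k)) (by norm_num) (by norm_num) (by norm_num)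
    have h1 := hdle n _ hmid
    rw [← smul_add, norm_smul, mul_pow] at h1
    have h2 := parallelogram_law_with_norm ℝ (x n) (x k)
    have h3 := hxd n
    have h4 := hxd k
    have h5 : d k ≤ L := le_ciSup hdb k
    have h6 : (1 : ℝ) / (k + 1 : ℝ) ≤ 1 / (n + 1 : ℝ) := by gcongr
    norm_num at h1
    have h7 := hdmono hnk
    nlinarith
  have hlim : Tendsto (fun n : ℕ => 4 * (L - d n) + 4 * (1 / (n + 1 : ℝ))) atTop (𝓝 0) := by
    have := ((tendsto_const_nhds (x := L)).sub hdlim).const_mul 4 |>.add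
      ((tendsto_one_div_add_atTop_nhds_zero_nat (𝕜 := ℝ)).const_mul 4)
    simpa using this
  rw [Metric.cauchySeq_iff']
  intro ε hε
  obtain ⟨N, hN⟩ := (hlim.eventually (gt_mem_nhds (show 0 < ε ^ 2 by positivity))).exists
  refine ⟨N, fun n hn => ?_⟩
  rw [dist_comm, dist_eq_norm]
  exact lt_of_pow_lt_pow_left₀ 2 hε.le ((hdist N n hn).trans_lt hN)

variable {Ω : Type*} {mΩ : MeasurableSpace Ω} {P : Measure Ω} [IsFiniteMeasure P]

/-- A decreasing sequence of nonempty, uniformly bounded, convex, boundedly closed subsets of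
`L^∞` has a common point. This is where weak compactness of balls enters; it is obtained from
completeness of `L²`. -/
lemma exists_mem_forall_of_antitone_convex (S : ℕ → Set (LInf P)) (hanti : Antitone S)
    (hconv : ∀ n, Convex ℝ (S n)) (hne : ∀ n, (S n).Nonempty) {C : ℝ}
    (hb : ∀ n, ∀ x ∈ S n, ‖x‖ ≤ C) (hcl : ∀ n, IsBoundedlyClosed (S n)) : ∃ Y, ∀ n, Y ∈ S n := by
  have hC : 0 ≤ C := by
    obtain ⟨x, hx⟩ := hne 0
    exact (norm_nonneg x).trans (hb 0 x hx)
  have hm : ∀ X : LInf P, MemLp X 2 P := fun X => (Lp.memLp X).mono_exponent le_top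
  let j : LInf P →ₗ[ℝ] Lp ℝ 2 P :=
    { toFun := fun X => (hm X).toLp X
      map_add' := fun X Y => by
        rw [← MemLp.toLp_add, MemLp.toLp_eq_toLp_iff]
        exact Lp.coeFn_add X Y
      map_smul' := fun c X => by
        rw [RingHom.id_apply, ← MemLp.toLp_const_smul, MemLp.toLp_eq_toLp_iff]
        exact Lp.coeFn_smul c X }
  have hj : ∀ X, j X =ᵐ[P] X := fun X => (hm X).coeFn_toLp
  obtain ⟨x, hxS, hx⟩ := exists_cauchySeq_of_antitone_convex (fun n => j '' S n)
    (fun m n h => Set.image_mono (hanti h)) (fun n => (hconv n).linear_image j)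
    (fun n => (hne n).image j) (C := (P.real Set.univ) ^ (ENNReal.toReal 2)⁻¹ * C) (by
      rintro n _ ⟨X, hX, rfl⟩
      refine Lp.norm_le_of_ae_bound hC ?_
      filter_upwards [hj X, ae_abs_le_norm X] with ω h1 h2
      rw [h1]; exact h2.trans (hb n X hX))
  choose X hXS hXx using hxS
  obtain ⟨y, hy⟩ := cauchySeq_tendsto_of_complete hx
  obtain ⟨ns, hns, hae⟩ := (tendstoInMeasure_of_tendsto_Lp hy).exists_seq_tendsto_ae
  have hae' : ∀ᵐ ω ∂P, Tendsto (fun i => X (ns i) ω) atTop (𝓝 (y ω)) := by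
    filter_upwards [hae, ae_all_iff.2 fun i => hj (X i)] with ω h1 h2
    refine h1.congr fun i => ?_
    rw [← hXx, h2]
  have hyb : ∀ᵐ ω ∂P, |y ω| ≤ C := by
    filter_upwards [hae', ae_all_iff.2 fun i => ae_abs_le_norm (X i)] with ω h1 h2
    exact le_of_tendsto h1.abs (Eventually.of_forall fun i => (h2 _).trans (hb _ _ (hXS _)))
  obtain ⟨Y, hY⟩ := exists_LInf_ae_eq (Lp.aestronglyMeasurable y) hyb
  refine ⟨Y, fun n => hcl n (fun i => X (ns (i + n))) Y C
    (fun i => hanti ((Nat.le_add_left n i).trans (hns.id_le _)) (hXS _))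
    (fun i => hb _ _ (hXS _)) ?_⟩
  filter_upwards [hae', hY] with ω h1 h2
  rw [h2]
  exact h1.comp (tendsto_add_atTop_nat n)

end Nested

/-! ### Penalties on `L^∞` -/

section Penalty
variable {Ω : Type*} {mΩ : MeasurableSpace Ω} {P : Measure Ω}

lemma ae_convex_comb (X Y : LInf P) (a b : ℝ) :
    ∀ᵐ ω ∂P, (a • X + b • Y) ω = a * X ω + b * Y ω := by
  filter_upwards [Lp.coeFn_add (a • X) (b • Y), Lp.coeFn_smul a X, Lp.coeFn_smul b Y]
    with ω h1 h2 h3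
  rw [h1, Pi.add_apply, h2, h3]; rfl

/-- Convex functionals on `L^∞` that are continuous along bounded a.s. convergent sequences and
are dominated by a multiple of the `L¹`-norm. -/
structure IsPenalty (Φ : LInf P → ℝ) : Prop where
  convexOn : ConvexOn ℝ Set.univ Φ
  tendsto : ∀ (X : ℕ → LInf P) (Y : LInf P) (C : ℝ), (∀ n, ‖X n‖ ≤ C) →
    (∀ᵐ ω ∂P, Tendsto (fun n => X n ω) atTop (𝓝 (Y ω))) →
    Tendsto (fun n => Φ (X n)) atTop (𝓝 (Φ Y))
  le_integral_abs : ∃ K : ℝ, 0 ≤ K ∧ ∀ Y, Φ Y ≤ K * ∫ ω, |Y ω| ∂P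

lemma isPenalty_zero : IsPenalty (fun _ : LInf P => (0 : ℝ)) where
  convexOn := convexOn_const 0 convex_univ
  tendsto := fun _ _ _ _ _ => tendsto_const_nhds
  le_integral_abs := ⟨0, le_rfl, by simp⟩

lemma IsPenalty.add_const_mul {Φ Ψ : LInf P → ℝ} (h : IsPenalty Φ) (h' : IsPenalty Ψ) {c : ℝ}
    (hc : 0 ≤ c) : IsPenalty (fun Y => Φ Y + c * Ψ Y) where
  convexOn := h.convexOn.add (h'.convexOn.smul hc)
  tendsto := fun X Y C hb hl => (h.tendsto X Y C hb hl).add ((h'.tendsto X Y C hb hl).const_mul c)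
  le_integral_abs := by
    obtain ⟨K, hK, h1⟩ := h.le_integral_abs
    obtain ⟨K', hK', h2⟩ := h'.le_integral_abs
    refine ⟨K + c * K', by positivity, fun Y => ?_⟩
    have := mul_le_mul_of_nonneg_left (h2 Y) hc
    have := h1 Y
    linarith

/-- The expected excess of `|Y|` over the level `n`. -/
noncomputable def excess (n : ℕ) (Y : LInf P) : ℝ := ∫ ω, max (|Y ω| - n) 0 ∂P

lemma excess_nonneg (n : ℕ) (Y : LInf P) : 0 ≤ excess n Y :=
  integral_nonneg fun _ => le_max_right _ _

lemma excess_eq_zero {n : ℕ} {Y : LInf P} (h : ‖Y‖ ≤ n) : excess n Y = 0 := by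
  refine integral_eq_zero_of_ae ?_
  filter_upwards [ae_abs_le_norm Y] with ω hω
  simpa using hω.trans h

variable [IsFiniteMeasure P]

lemma integrable_excess (n : ℕ) (Y : LInf P) : Integrable (fun ω => max (|Y ω| - n) 0) P :=
  ((integrable_LInf Y).abs.sub (integrable_const _)).pos_part

lemma norm_le_of_excess_eq_zero {n : ℕ} {Y : LInf P} (h : excess n Y = 0) : ‖Y‖ ≤ n := by
  refine norm_le_of_ae_abs_le (by positivity) ?_
  have := (integral_eq_zero_iff_of_nonneg (fun _ => le_max_right _ _) (integrable_excess n Y)).1 h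
  filter_upwards [this] with ω hω
  simpa using hω

lemma isPenalty_excess (n : ℕ) : IsPenalty (excess n : LInf P → ℝ) where
  convexOn := by
    refine ⟨convex_univ, fun X _ Y _ a b ha hb hab => ?_⟩
    have : a • excess n X + b • excess n Y
        = ∫ ω, a * max (|X ω| - n) 0 + b * max (|Y ω| - n) 0 ∂P := by
      rw [integral_add ((integrable_excess n X).const_mul a) ((integrable_excess n Y).const_mul b),
        integral_const_mul, integral_const_mul]
      rfl
    rw [this]
    refine integral_mono_ae (integrable_excess n _)
      (((integrable_excess n X).const_mul a).add ((integrable_excess n Y).const_mul b)) ?_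
    filter_upwards [ae_convex_comb X Y a b] with ω h
    simp only [h]
    have h1 : |a * X ω + b * Y ω| ≤ a * |X ω| + b * |Y ω| := by
      refine (abs_add_le _ _).trans (le_of_eq ?_)
      rw [abs_mul, abs_mul, abs_of_nonneg ha, abs_of_nonneg hb]
    have h2 := mul_le_mul_of_nonneg_left (le_max_left (|X ω| - n) 0) ha
    have h3 := mul_le_mul_of_nonneg_left (le_max_left (|Y ω| - n) 0) hb
    have h4 : (n : ℝ) = a * n + b * n := by rw [← add_mul, hab, one_mul]
    have h5 := le_max_right (|X ω| - n) 0
    have h6 := le_max_right (|Y ω| - n) 0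
    refine max_le ?_ (by positivity)
    linarith
  tendsto := fun X Y C hb hl => by
    refine tendsto_integral_of_dominated_convergence (fun _ => C)
      (fun k => (integrable_excess n (X k)).aestronglyMeasurable) (integrable_const _) ?_ ?_
    · intro k
      filter_upwards [ae_abs_le_norm (X k)] with ω hω
      have h0 := (abs_nonneg _).trans (hω.trans (hb k))
      rw [Real.norm_of_nonneg (le_max_right _ _)]
      refine max_le ?_ h0
      have : (0 : ℝ) ≤ n := by positivity
      linarith [hb k]
    · filter_upwards [hl] with ω hω
      exact (hω.abs.sub_const _).max tendsto_const_nhds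
  le_integral_abs := by
    refine ⟨1, zero_le_one, fun Y => ?_⟩
    rw [one_mul]
    refine integral_mono (integrable_excess n Y) (integrable_LInf Y).abs fun ω => ?_
    have : (0 : ℝ) ≤ n := by positivity
    exact max_le (by linarith) (abs_nonneg _)

/-- If a penalty exceeds `1` on the part of `D` in the ball of radius `n`, then a large multiple of
the excess over `n` can be added so that it exceeds `1` on the part of `D` in the ball of radius
`n + 1`. -/
lemma IsPenalty.exists_extend {D : Set (LInf P)} (hD : Convex ℝ D) (hcl : IsBoundedlyClosed D)
    {Φ : LInf P → ℝ} (hΦ : IsPenalty Φ) {n : ℕ} (h : ∀ Y ∈ D, ‖Y‖ ≤ n → 1 < Φ Y) :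
    ∃ c : ℝ, 0 ≤ c ∧ ∀ Y ∈ D, ‖Y‖ ≤ (n + 1 : ℕ) → 1 < Φ Y + c * excess n Y := by
  by_contra! hcon
  let S : ℕ → Set (LInf P) := fun k =>
    D ∩ (Metric.closedBall 0 (n + 1 : ℕ) ∩ {Y | Φ Y + k * excess n Y ≤ 1})
  have hpen : ∀ k : ℕ, IsPenalty fun Y => Φ Y + k * excess n Y := fun k =>
    hΦ.add_const_mul (isPenalty_excess n) (by positivity)
  obtain ⟨Y, hY⟩ := exists_mem_forall_of_antitone_convex S
    (fun k l hkl Y hY => ⟨hY.1, hY.2.1, le_trans (add_le_add_right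
      (mul_le_mul_of_nonneg_right (Nat.cast_le.2 hkl) (excess_nonneg n Y)) _) hY.2.2⟩)
    (fun k => hD.inter ((convex_closedBall _ _).inter (by
      simpa using (hpen k).convexOn.convex_le 1)))
    (fun k => by
      obtain ⟨Y, hYD, hYn, hY1⟩ := hcon k (by positivity)
      exact ⟨Y, hYD, by simpa using hYn, hY1⟩)
    (C := (n + 1 : ℕ)) (fun k Y hY => by simpa using hY.2.1)
    (fun k => hcl.inter (fun X Y C hX hb hl => ⟨by
      rw [mem_closedBall_zero_iff]
      exact norm_le_of_tendsto (fun k => by simpa using (hX k).1) hl,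
      le_of_tendsto ((hpen k).tendsto X Y C hb hl) (Eventually.of_forall fun i => (hX i).2)⟩))
  have hex : excess n Y = 0 := by
    by_contra hne
    have hpos := (excess_nonneg n Y).lt_of_ne' hne
    obtain ⟨k, hk⟩ := exists_nat_gt ((1 - Φ Y) / excess n Y)
    rw [div_lt_iff₀ hpos] at hk
    have h1 : Φ Y + k * excess n Y ≤ 1 := (hY k).2.2
    linarith
  have h0 : Φ Y + (0 : ℕ) * excess n Y ≤ 1 := (hY 0).2.2
  have := h Y (hY 0).1 (norm_le_of_excess_eq_zero hex)
  simp at h0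
  linarith

/-- A convex neighbourhood of `0` disjoint from `D`, which contains every `Y` with `‖Y‖ ≤ M` and
small `L¹`-norm. -/
lemma exists_convex_disjoint {D : Set (LInf P)} (hD : Convex ℝ D) (hcl : IsBoundedlyClosed D)
    (h0 : (0 : LInf P) ∉ D) : ∃ U : Set (LInf P), Convex ℝ U ∧ Disjoint U D ∧
      ∀ M : ℕ, ∃ δ > 0, ∀ Y : LInf P, ‖Y‖ ≤ M → ∫ ω, |Y ω| ∂P ≤ δ → Y ∈ U := by
  let T : ℕ → Type _ := fun n => {Φ : LInf P → ℝ // IsPenalty Φ ∧ ∀ Y ∈ D, ‖Y‖ ≤ n → 1 < Φ Y}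
  have hstep : ∀ n (Φ : T n), ∃ c : ℝ, 0 ≤ c ∧
      ∀ Y ∈ D, ‖Y‖ ≤ (n + 1 : ℕ) → 1 < Φ.1 Y + c * excess n Y := fun n Φ =>
    Φ.2.1.exists_extend hD hcl Φ.2.2
  choose c hc hcD using hstep
  -- At level `0` there is nothing to exceed, as `D` does not meet the ball of radius `0`.
  let F : ∀ n, T n := fun n => Nat.rec
    ⟨fun _ => 0, isPenalty_zero, fun Y hY hn => by
      have : Y = 0 := by simpa using hn
      exact absurd (this ▸ hY) h0⟩
    (fun n Φ => ⟨fun Y => Φ.1 Y + c n Φ * excess n Y,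
      Φ.2.1.add_const_mul (isPenalty_excess n) (hc n Φ), hcD n Φ⟩) n
  have hF : ∀ n Y, (F (n + 1)).1 Y = (F n).1 Y + c n (F n) * excess n Y := fun n Y => rfl
  have hmono : ∀ Y, Monotone fun n => (F n).1 Y := fun Y => monotone_nat_of_le_succ fun n => by
    rw [hF]
    have := mul_nonneg (hc n (F n)) (excess_nonneg n Y)
    linarith
  -- Terms with index at least `M` vanish on the ball of radius `M`, so that the supremum over `n`
  -- is finite and attained at `M`.
  have hconst : ∀ (M : ℕ) Y, ‖Y‖ ≤ M → ∀ n, (F n).1 Y ≤ (F M).1 Y := by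
    intro M Y hY n
    rcases le_total n M with h | h
    · exact hmono Y h
    · induction n, h using Nat.le_induction with
      | base => exact le_rfl
      | succ n hn ih =>
        rw [hF, excess_eq_zero (hY.trans (by exact_mod_cast hn)), mul_zero, add_zero]
        exact ih
  refine ⟨{Y | ∀ n, (F n).1 Y ≤ 1}, ?_, ?_, ?_⟩
  · rw [Set.ofPred_forall]
    exact convex_iInter fun n => by simpa using (F n).2.1.convexOn.convex_le 1
  · rw [Set.disjoint_left]
    intro Y hY hYD
    obtain ⟨n, hn⟩ := exists_nat_ge ‖Y‖
    exact absurd ((F n).2.2 Y hYD hn) (not_lt.2 (hY n))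
  · intro M
    obtain ⟨K, hK, hle⟩ := (F M).2.1.le_integral_abs
    refine ⟨1 / (K + 1), by positivity, fun Y hY hYδ n => ?_⟩
    refine (hconst M Y hY n).trans ((hle Y).trans ?_)
    calc K * ∫ ω, |Y ω| ∂P ≤ K * (1 / (K + 1)) := by gcongr
      _ ≤ 1 := by
        rw [mul_one_div, div_le_one (by positivity)]; linarith

end Penalty

/-! ### Functionals given by integrable densities -/

section Density
variable {Ω : Type*} {mΩ : MeasurableSpace Ω} {P : Measure Ω}

/-- Integration against an integrable density, as a continuous linear functional on `L^∞`. -/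
noncomputable def integralMulCLM {Z : Ω → ℝ} (hZ : Integrable Z P) : LInf P →L[ℝ] ℝ :=
  LinearMap.mkContinuous
    { toFun := fun X => ∫ ω, Z ω * X ω ∂P
      map_add' := integral_mul_add hZ
      map_smul' := integral_mul_smul } (∫ ω, |Z ω| ∂P) (fun X => by
    rw [← MeasureTheory.integral_mul_const]
    refine (norm_integral_le_integral_norm _).trans (integral_mono_ae
      (integrable_mul_LInf hZ X).norm (hZ.abs.mul_const _) ?_)
    filter_upwards [ae_abs_le_norm X] with ω h
    simp only [norm_mul, Real.norm_eq_abs]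
    gcongr)

@[simp] lemma integralMulCLM_apply {Z : Ω → ℝ} (hZ : Integrable Z P) (X : LInf P) :
    integralMulCLM hZ X = ∫ ω, Z ω * X ω ∂P := rfl

variable [IsFiniteMeasure P]

/-- Bounded random variables are uniform limits of linear combinations of indicators. -/
lemma eq_zero_of_indicator_eq_zero (l : LInf P →L[ℝ] ℝ)
    (h : ∀ (A : Set Ω) (hA : MeasurableSet A), l (indicatorConstLp ∞ hA (measure_ne_top P A) 1) = 0)
    (X : LInf P) : l X = 0 := by
  have hkey : ∀ ε > 0, |l X| ≤ ‖l‖ * ε := by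
    intro ε hε
    set f : Ω → ℝ := (Lp.aestronglyMeasurable X).mk X with hf
    have hfm : Measurable f := (Lp.aestronglyMeasurable X).stronglyMeasurable_mk.measurable
    have hfX : X =ᵐ[P] f := (Lp.aestronglyMeasurable X).ae_eq_mk
    let A : ℤ → Set Ω := fun k => {ω | ⌊f ω / ε⌋ = k}
    have hA : ∀ k, MeasurableSet (A k) := fun k =>
      (hfm.div_const ε).floor (measurableSet_singleton k)
    obtain ⟨N, hN⟩ := exists_nat_ge (‖X‖ / ε)
    let X' : LInf P := ∑ k ∈ Finset.Icc (-(N + 1 : ℤ)) (N + 1),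
      ((k : ℝ) * ε) • indicatorConstLp ∞ (hA k) (measure_ne_top P _) (1 : ℝ)
    have hX' : l X' = 0 := by
      simp only [X', map_sum, map_smul, h, smul_zero, Finset.sum_const_zero]
    have hdiff : ‖X - X'‖ ≤ ε := by
      refine norm_le_of_ae_abs_le hε.le ?_
      have hs : ∀ᵐ ω ∂P, X' ω = ∑ k ∈ Finset.Icc (-(N + 1 : ℤ)) (N + 1),
          ((k : ℝ) * ε) * (A k).indicator (fun _ => (1 : ℝ)) ω := by
        have h1 := Lp.coeFn_fun_finsetSum (Finset.Icc (-(N + 1 : ℤ)) (N + 1)) (fun k : ℤ =>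
          ((k : ℝ) * ε) • indicatorConstLp ∞ (hA k) (measure_ne_top P _) (1 : ℝ))
        have h2 := ae_all_iff.2 fun k : ℤ => Lp.coeFn_smul ((k : ℝ) * ε)
          (indicatorConstLp ∞ (hA k) (measure_ne_top P _) (1 : ℝ))
        have h3 := ae_all_iff.2 fun k : ℤ => indicatorConstLp_coeFn (p := ∞) (hs := hA k)
          (hμs := measure_ne_top P _) (c := (1 : ℝ))
        filter_upwards [h1, h2, h3] with ω h1 h2 h3
        rw [h1]
        refine Finset.sum_congr rfl fun k _ => ?_
        rw [h2 k, Pi.smul_apply, h3 k, smul_eq_mul]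
      filter_upwards [Lp.coeFn_sub X X', hs, hfX, ae_abs_le_norm X] with ω h1 h2 h3 h4
      rw [h1, Pi.sub_apply, h2, Finset.sum_eq_single ⌊f ω / ε⌋]
      · rw [Set.indicator_of_mem (by rfl), h3, mul_one]
        have h5 := Int.floor_le (f ω / ε)
        have h6 := Int.lt_floor_add_one (f ω / ε)
        rw [le_div_iff₀ hε] at h5
        rw [div_lt_iff₀ hε] at h6
        rw [abs_le]; constructor <;> linarith
      · intro k _ hk
        rw [Set.indicator_of_notMem (fun h => hk h.symm), mul_zero]
      · intro hk
        exfalso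
        apply hk
        rw [h3] at h4
        have h5 : |f ω / ε| ≤ N := by
          rw [abs_div, abs_of_pos hε]
          exact (div_le_div_of_nonneg_right h4 hε.le).trans hN
        rw [abs_le] at h5
        rw [Finset.mem_Icc]
        constructor
        · rw [Int.le_floor]; push_cast; linarith
        · rw [← Int.lt_add_one_iff, Int.floor_lt]; push_cast; linarith
    have := l.le_opNorm (X - X')
    rw [map_sub, hX', sub_zero] at this
    exact this.trans (by gcongr)
  have hlim : Tendsto (fun n : ℕ => ‖l‖ * (1 / (n + 1 : ℝ))) atTop (𝓝 0) := by
    simpa using (tendsto_one_div_add_atTop_nhds_zero_nat (𝕜 := ℝ)).const_mul ‖l‖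
  exact abs_nonpos_iff.1 (ge_of_tendsto' hlim fun n => hkey _ (by positivity))

open Classical in
/-- A continuous linear functional on `L^∞` that is small on bounded elements of small `L¹`-norm is
represented by an integrable density: its values on indicators form a signed measure that is
absolutely continuous with respect to `P`. -/
lemma exists_integrable_density (l : LInf P →L[ℝ] ℝ)
    (hl : ∀ ε > 0, ∃ δ > 0, ∀ Y : LInf P, ‖Y‖ ≤ 1 → ∫ ω, |Y ω| ∂P ≤ δ → |l Y| ≤ ε) :
    ∃ Z : Ω → ℝ, Integrable Z P ∧ ∀ X, l X = ∫ ω, Z ω * X ω ∂P := by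
  let ind : ∀ A : Set Ω, MeasurableSet A → LInf P := fun A hA =>
    indicatorConstLp ∞ hA (measure_ne_top P A) (1 : ℝ)
  have hind : ∀ A hA, ind A hA =ᵐ[P] A.indicator fun _ => (1 : ℝ) := fun A hA =>
    indicatorConstLp_coeFn
  let s : SignedMeasure Ω :=
    { measureOf' := fun A => if hA : MeasurableSet A then l (ind A hA) else 0
      empty' := by
        have : ind ∅ MeasurableSet.empty = 0 := indicatorConstLp_empty
        simp [this]
      not_measurable' := fun A hA => by simp [hA]
      m_iUnion' := fun A hA hdisj => by
        simp only [hA, MeasurableSet.iUnion hA, dif_pos]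
        rw [HasSum, SummationFilter.unconditional_filter, Metric.tendsto_nhds]
        intro ε hε
        obtain ⟨δ, hδ, hlδ⟩ := hl (ε / 2) (by positivity)
        have hsum : HasSum (fun i => P.real (A i)) (P.real (⋃ i, A i)) := by
          simp only [measureReal_def, measure_iUnion hdisj hA,
            ENNReal.tsum_toReal_eq fun i => measure_ne_top P (A i)]
          exact ENNReal.hasSum_toReal (by
            rw [← measure_iUnion hdisj hA]; exact measure_ne_top P _)
        have hev := hsum.eventually (Metric.ball_mem_nhds _ hδ)
        rw [SummationFilter.unconditional_filter] at hev
        filter_upwards [hev] with t ht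
        set Y : LInf P := ind (⋃ i, A i) (MeasurableSet.iUnion hA) - ∑ i ∈ t, ind (A i) (hA i)
          with hY
        have hYl : l Y = l (ind (⋃ i, A i) (MeasurableSet.iUnion hA))
            - ∑ i ∈ t, l (ind (A i) (hA i)) := by
          rw [hY, map_sub, map_sum]
        have hYae : ∀ᵐ ω ∂P, Y ω = (⋃ i, A i).indicator (fun _ => (1 : ℝ)) ω
            - ∑ i ∈ t, (A i).indicator (fun _ => (1 : ℝ)) ω := by
          filter_upwards [Lp.coeFn_sub (ind (⋃ i, A i) (MeasurableSet.iUnion hA))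
            (∑ i ∈ t, ind (A i) (hA i)), hind _ (MeasurableSet.iUnion hA),
            Lp.coeFn_fun_finsetSum t fun i => ind (A i) (hA i),
            ae_all_iff.2 fun i => hind (A i) (hA i)] with ω h1 h2 h3 h4
          rw [h1, Pi.sub_apply, h2, h3]
          congr 1
          exact Finset.sum_congr rfl fun i _ => h4 i
        have hpt : ∀ ω, (⋃ i, A i).indicator (fun _ => (1 : ℝ)) ω
            - ∑ i ∈ t, (A i).indicator (fun _ => (1 : ℝ)) ω ∈ Set.Icc (0 : ℝ) 1 := by
          intro ω
          rw [← Finset.indicator_biUnion_apply t A (fun i _ j _ hij => hdisj hij)]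
          have hsub : (⋃ i ∈ t, A i) ⊆ ⋃ i, A i := Set.iUnion₂_subset_iUnion _ _
          by_cases h1 : ω ∈ ⋃ i ∈ t, A i
          · rw [Set.indicator_of_mem h1, Set.indicator_of_mem (hsub h1)]; norm_num
          · rw [Set.indicator_of_notMem h1, sub_zero]
            by_cases h2 : ω ∈ ⋃ i, A i
            · rw [Set.indicator_of_mem h2]; norm_num
            · rw [Set.indicator_of_notMem h2]; norm_num
        have hYint : ∫ ω, |Y ω| ∂P = P.real (⋃ i, A i) - ∑ i ∈ t, P.real (A i) := by
          have : ∫ ω, |Y ω| ∂P = ∫ ω, ((⋃ i, A i).indicator (fun _ => (1 : ℝ)) ω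
            - ∑ i ∈ t, (A i).indicator (fun _ => (1 : ℝ)) ω) ∂P := by
            refine integral_congr_ae ?_
            filter_upwards [hYae] with ω h
            simp only [h]
            exact abs_of_nonneg (hpt ω).1
          rw [this, integral_sub, integral_finsetSum]
          · simp only [integral_indicator_const (1 : ℝ) (hA _), smul_eq_mul, mul_one,
              integral_indicator_const (1 : ℝ) (MeasurableSet.iUnion hA)]
          · exact fun i _ => (integrable_const _).indicator (hA i)
          · exact (integrable_const _).indicator (MeasurableSet.iUnion hA)
          · exact integrable_finsetSum _ fun i _ => (integrable_const _).indicator (hA i)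
        have h1 : |l Y| ≤ ε / 2 := by
          refine hlδ Y (norm_le_of_ae_abs_le zero_le_one ?_) ?_
          · filter_upwards [hYae] with ω h
            rw [h, abs_of_nonneg (hpt ω).1]
            exact (hpt ω).2
          · rw [hYint]
            rw [dist_comm, Real.dist_eq] at ht
            exact (le_abs_self _).trans ht.le
        rw [dist_comm, Real.dist_eq, ← hYl]
        linarith }
  have hs : ∀ A (hA : MeasurableSet A), s A = l (ind A hA) := fun A hA => dif_pos hA
  have hac : s ≪ᵥ P.toENNRealVectorMeasure := by
    refine VectorMeasure.AbsolutelyContinuous.mk fun A hA h0 => ?_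
    rw [Measure.toENNRealVectorMeasure_apply_measurable hA] at h0
    rw [hs A hA]
    have : ind A hA = 0 := by
      rw [Lp.ext_iff]
      filter_upwards [hind A hA, Lp.coeFn_zero ℝ ∞ P, indicator_meas_zero (f := fun _ => (1 : ℝ)) h0]
        with ω h1 h2 h3
      rw [h1, h2, h3]
    rw [this, map_zero]
  have hrn := SignedMeasure.withDensityᵥ_rnDeriv_eq s P hac
  have hZ : Integrable (s.rnDeriv P) P := SignedMeasure.integrable_rnDeriv s P
  refine ⟨s.rnDeriv P, hZ, fun X => ?_⟩
  have := eq_zero_of_indicator_eq_zero (l - integralMulCLM hZ) (fun A hA => by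
    have h1 : s A = ∫ ω in A, s.rnDeriv P ω ∂P := by
      conv_lhs => rw [← hrn]
      exact withDensityᵥ_apply hZ hA
    rw [sub_apply, integralMulCLM_apply, sub_eq_zero]
    change l (ind A hA) = _
    rw [← hs A hA, h1, ← integral_indicator hA]
    refine integral_congr_ae ?_
    filter_upwards [hind A hA] with ω h
    change _ = _ * ind A hA ω
    rw [h]
    by_cases hω : ω ∈ A <;> simp [hω]) X
  rwa [sub_apply, integralMulCLM_apply, sub_eq_zero] at this

/-- A form of the Krein-Šmulian theorem for `L^∞`: a convex, boundedly closed set not containing `0`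
is separated from `0` by an integrable density. -/
theorem exists_integrable_separation {D : Set (LInf P)} (hD : Convex ℝ D)
    (hcl : IsBoundedlyClosed D) (h0 : (0 : LInf P) ∉ D) :
    ∃ Z : Ω → ℝ, Integrable Z P ∧ ∃ s > 0, ∀ Y ∈ D, s ≤ ∫ ω, Z ω * Y ω ∂P := by
  obtain rfl | hne := D.eq_empty_or_nonempty
  · exact ⟨0, integrable_zero _ _ _, 1, zero_lt_one, by simp⟩
  obtain ⟨U, hU, hdisj, hmem⟩ := exists_convex_disjoint hD hcl h0
  have habs : ∀ Y : LInf P, ∫ ω, |Y ω| ∂P ≤ ‖Y‖ * P.real Set.univ := fun Y => by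
    calc ∫ ω, |Y ω| ∂P ≤ ∫ _, ‖Y‖ ∂P :=
        integral_mono_ae (integrable_LInf Y).abs (integrable_const _) (ae_abs_le_norm Y)
      _ = ‖Y‖ * P.real Set.univ := by rw [integral_const, smul_eq_mul, mul_comm]
  obtain ⟨r, hr, hball⟩ : ∃ r > 0, ∀ Y : LInf P, ‖Y‖ ≤ r → Y ∈ U := by
    obtain ⟨δ, hδ, h⟩ := hmem 1
    refine ⟨min 1 (δ / (P.real Set.univ + 1)), by positivity, fun Y hY => ?_⟩
    refine h Y (by simpa using hY.trans (min_le_left _ _)) ((habs Y).trans ?_)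
    calc ‖Y‖ * P.real Set.univ
        ≤ δ / (P.real Set.univ + 1) * (P.real Set.univ + 1) := by
          gcongr
          · exact hY.trans (min_le_right _ _)
          · linarith
      _ = δ := by field_simp
  have hint : (0 : LInf P) ∈ interior U :=
    mem_interior_iff_mem_nhds.2 (Filter.mem_of_superset (Metric.closedBall_mem_nhds _ hr)
      fun Y hY => hball Y (by simpa using hY))
  obtain ⟨l, u, hl0, hlU, hlD⟩ := geometric_hahn_banach_of_nonempty_interior hU hD
    (hdisj.mono_left interior_subset) ⟨0, hint⟩ hne
  -- A functional that is nonpositive on a ball vanishes.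
  have hu : 0 < u := by
    by_contra! hu
    apply hl0
    have h1 : ∀ Y : LInf P, ‖Y‖ ≤ r → l Y ≤ 0 := fun Y hY => (hlU Y (hball Y hY)).trans hu
    ext X
    have h2 : ∀ X : LInf P, l X ≤ 0 := by
      intro X
      have h3 := h1 ((r / (‖X‖ + 1)) • X) (by
        rw [norm_smul, Real.norm_of_nonneg (by positivity), div_mul_eq_mul_div,
          div_le_iff₀ (by positivity)]
        nlinarith [norm_nonneg X])
      rw [map_smul, smul_eq_mul] at h3
      exact nonpos_of_mul_nonpos_right h3 (by positivity)
    have h4 := h2 X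
    have h5 := h2 (-X)
    rw [map_neg] at h5
    rw [zero_apply]
    linarith
  obtain ⟨Z, hZ, hlZ⟩ := exists_integrable_density l (fun ε hε => by
    -- If `‖Y‖ ≤ 1` and `Y` has small `L¹`-norm, then `M • Y ∈ U` and hence `l Y ≤ u / M`.
    obtain ⟨M, hM⟩ := exists_nat_gt (u / ε)
    have hM0 : (0 : ℝ) < M := (by positivity : 0 < u / ε).trans hM
    obtain ⟨δ, hδ, h⟩ := hmem M
    refine ⟨δ / M, by positivity, fun Y hY hYδ => ?_⟩
    have hsc : ∀ X : LInf P, ‖X‖ ≤ 1 → ∫ ω, |X ω| ∂P ≤ δ / M → l X ≤ ε := by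
      intro X hX hXδ
      have h1 := hlU _ (h ((M : ℝ) • X) (by
        rw [norm_smul, Real.norm_of_nonneg hM0.le]
        nlinarith) (by
        have : ∫ ω, |((M : ℝ) • X) ω| ∂P = M * ∫ ω, |X ω| ∂P := by
          rw [← integral_const_mul]
          refine integral_congr_ae ?_
          filter_upwards [Lp.coeFn_smul (M : ℝ) X] with ω h
          rw [h, Pi.smul_apply, smul_eq_mul, abs_mul, abs_of_pos hM0]
        rw [this, mul_comm]
        exact (le_div_iff₀ hM0).1 hXδ))
      rw [map_smul, smul_eq_mul] at h1
      rw [div_lt_iff₀ hε] at hM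
      nlinarith
    rw [abs_le]
    refine ⟨?_, hsc Y hY hYδ⟩
    have h2 := hsc (-Y) (by rwa [norm_neg]) (by
      refine le_trans (le_of_eq ?_) hYδ
      refine integral_congr_ae ?_
      filter_upwards [Lp.coeFn_neg Y] with ω h
      rw [h, Pi.neg_apply, abs_neg])
    rw [map_neg] at h2
    linarith)
  exact ⟨Z, hZ, u, hu, fun Y hY => (hlD Y hY).trans (hlZ Y).le⟩

end Density

/-! ### Fatou functionals -/

section Fatou
variable {Ω : Type*} {mΩ : MeasurableSpace Ω} {P : Measure Ω}

lemma isFatou_iff {ρ : LInf P → ℝ} : IsFatou ρ ↔ ∀ (X : ℕ → LInf P) (Y : LInf P),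
    (∃ C : ℝ, ∀ n, ‖X n‖ ≤ C) → (∀ᵐ ω ∂P, Tendsto (fun n => X n ω) atTop (𝓝 (Y ω))) →
    ∀ r < ρ Y, ∀ᶠ n in atTop, r < ρ (X n) := by
  refine forall₄_congr fun X Y _ _ => ?_
  rw [Filter.le_liminf_iff]
  constructor
  · intro h r hr
    filter_upwards [h r (EReal.coe_lt_coe_iff.2 hr)] with n hn
    exact EReal.coe_lt_coe_iff.1 hn
  · intro h y hy
    obtain ⟨r, hyr, hr⟩ := EReal.lt_iff_exists_real_btwn.1 hy
    filter_upwards [h r (EReal.coe_lt_coe_iff.1 hr)] with n hn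
    exact hyr.trans (EReal.coe_lt_coe_iff.2 hn)

lemma isFatou_integral_mul {Z : Ω → ℝ} (hZ : Integrable Z P) :
    IsFatou fun X : LInf P => ∫ ω, Z ω * X ω ∂P :=
  isFatou_iff.2 fun _ _ ⟨_, hC⟩ hl _ hr => (tendsto_integral_mul hZ hC hl).eventually_const_lt hr

lemma IsFatou.add_integral_mul {τ : LInf P → ℝ} (hτ : IsFatou τ) {Z : Ω → ℝ}
    (hZ : Integrable Z P) : IsFatou fun X : LInf P => ∫ ω, Z ω * X ω ∂P + τ X := by
  refine isFatou_iff.2 fun X Y ⟨C, hC⟩ hl r hr => ?_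
  have h1 := (tendsto_integral_mul hZ hC hl).eventually_const_lt
    (show ∫ ω, Z ω * Y ω ∂P - (∫ ω, Z ω * Y ω ∂P + τ Y - r) / 2 < ∫ ω, Z ω * Y ω ∂P by linarith)
  have h2 := isFatou_iff.1 hτ X Y ⟨C, hC⟩ hl
    (τ Y - (∫ ω, Z ω * Y ω ∂P + τ Y - r) / 2) (by linarith)
  filter_upwards [h1, h2] with n h1 h2
  linarith

lemma isFatou_of_isLUB {ι : Type*} {g : ι → LInf P → ℝ} (hg : ∀ i, IsFatou (g i))
    {ρ : LInf P → ℝ} (hρ : ∀ X, IsLUB (Set.range fun i => g i X) (ρ X)) : IsFatou ρ := by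
  refine isFatou_iff.2 fun X Y hb hl r hr => ?_
  obtain ⟨_, ⟨i, rfl⟩, hi⟩ := (lt_isLUB_iff (hρ Y)).1 hr
  filter_upwards [isFatou_iff.1 (hg i) X Y hb hl r hi] with n hn
  exact hn.trans_le ((hρ (X n)).1 ⟨i, rfl⟩)

end Fatou

/-! ### Representation of coherent risk measures by densities -/

section Representation
variable {Ω : Type*} {mΩ : MeasurableSpace Ω} {P : Measure Ω}

/-- The integrable densities `Z` for which `X ↦ E[Z X]` is dominated by `ρ`. -/
def dominatedDensities (ρ : LInf P → ℝ) : Set (Ω → ℝ) :=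
  {Z | Integrable Z P ∧ ∀ X : LInf P, ∫ ω, Z ω * X ω ∂P ≤ ρ X}

variable [IsFiniteMeasure P] {ρ : LInf P → ℝ}

lemma IsCoherent.map_zero (h : IsCoherent ρ) : ρ 0 = 0 := by
  simpa using h.positive_homogeneity 0 0 le_rfl

lemma IsCoherent.map_const (h : IsCoherent ρ) (c : ℝ) : ρ (Lp.const ∞ P c) = c := by
  simpa [h.map_zero] using h.cash_invariance 0 c

lemma IsCoherent.map_sub_const (h : IsCoherent ρ) (X : LInf P) (c : ℝ) :
    ρ (X - Lp.const ∞ P c) = ρ X - c := by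
  have := h.cash_invariance (X - Lp.const ∞ P c) c
  rw [sub_add_cancel] at this
  linarith

lemma le_const_norm (X : LInf P) : X ≤ Lp.const ∞ P ‖X‖ := by
  rw [← Lp.coeFn_le]
  filter_upwards [ae_abs_le_norm X, Lp.coeFn_const (p := ∞) (μ := P) ‖X‖] with ω h1 h2
  rw [h2]
  exact (le_abs_self _).trans h1

lemma IsCoherent.integral_eq_one (h : IsCoherent ρ) {Z : Ω → ℝ} (hZ : Z ∈ dominatedDensities ρ) :
    ∫ ω, Z ω ∂P = 1 := by
  have h1 := hZ.2 (Lp.const ∞ P 1)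
  have h2 := hZ.2 (Lp.const ∞ P (-1))
  rw [integral_mul_const, h.map_const] at h1 h2
  linarith

lemma IsCoherent.integral_mul_mono (h : IsCoherent ρ) {Z : Ω → ℝ} (hZ : Z ∈ dominatedDensities ρ)
    {X Y : LInf P} (hXY : X ≤ Y) : ∫ ω, Z ω * X ω ∂P ≤ ∫ ω, Z ω * Y ω ∂P := by
  have h1 := hZ.2 (X - Y)
  rw [integral_mul_sub hZ.1] at h1
  have h2 := h.monotonicity (X - Y) 0 (sub_nonpos.2 hXY)
  rw [h.map_zero] at h2
  linarith

/-- A Fatou coherent risk measure is the supremum of the expectations it dominates: separate `X`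
from the acceptance set `{ρ ≤ 0}`. -/
theorem IsCoherent.exists_lt_integral_mul (h : IsCoherent ρ) (hF : IsFatou ρ) {X : LInf P} {c : ℝ}
    (hc : c < ρ X) : ∃ Z ∈ dominatedDensities ρ, c < ∫ ω, Z ω * X ω ∂P := by
  set X₀ := X - Lp.const ∞ P c with hX₀
  have hpos : 0 < ρ X₀ := by rw [hX₀, h.map_sub_const]; linarith
  obtain ⟨Z', hZ', s, hs, hsep⟩ := exists_integrable_separation (D := {Y | ρ (Y + X₀) ≤ 0})
    (by
      intro Y hY Y' hY' a b ha hb hab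
      have hb' : b = 1 - a := by linarith
      subst hb'
      have h1 := h.convexity (Y + X₀) (Y' + X₀) a ha (by linarith)
      have h2 : a • (Y + X₀) + (1 - a) • (Y' + X₀) = a • Y + (1 - a) • Y' + X₀ := by
        module
      rw [h2] at h1
      have h3 : ρ (Y + X₀) ≤ 0 := hY
      have h4 : ρ (Y' + X₀) ≤ 0 := hY'
      change ρ _ ≤ 0
      nlinarith)
    (by
      intro Xs Y C hXs hb hl
      by_contra hY
      have hY' : 0 < ρ (Y + X₀) := not_le.1 hY
      have := isFatou_iff.1 hF (fun n => Xs n + X₀) (Y + X₀)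
        ⟨C + ‖X₀‖, fun n => (norm_add_le _ _).trans (by linarith [hb n])⟩ (by
          filter_upwards [hl, Lp.coeFn_add Y X₀, ae_all_iff.2 fun n => Lp.coeFn_add (Xs n) X₀]
            with ω h1 h2 h3
          simp only [h2, h3, Pi.add_apply]
          exact h1.add_const _) 0 hY'
      obtain ⟨n, hn⟩ := this.exists
      exact absurd hn (not_lt.2 (hXs n)))
    (by simpa using hpos)
  -- the linear functional is nonpositive on the acceptance cone and positive at `X₀`
  set Z : Ω → ℝ := fun ω => -Z' ω with hZdef
  have hZ : Integrable Z P := hZ'.neg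
  have hbound : ∀ A : LInf P, ρ A ≤ 0 → ∫ ω, Z ω * A ω ∂P ≤ ∫ ω, Z ω * X₀ ω ∂P - s := by
    intro A hA
    have h1 := hsep (A - X₀) (by simpa using hA)
    rw [integral_mul_sub hZ'] at h1
    simp only [hZdef, neg_mul, integral_neg]
    linarith
  have hX₀pos : 0 < ∫ ω, Z ω * X₀ ω ∂P := by
    have h1 := hbound ((0 : ℝ) • X₀) (by rw [zero_smul, h.map_zero])
    rw [integral_mul_smul] at h1
    linarith
  have hcone : ∀ A : LInf P, ρ A ≤ 0 → ∫ ω, Z ω * A ω ∂P ≤ 0 := by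
    intro A hA
    by_contra! hneg
    have h1 := hbound (((∫ ω, Z ω * X₀ ω ∂P) / ∫ ω, Z ω * A ω ∂P) • A) (by
      rw [h.positive_homogeneity _ _ (by positivity)]
      exact mul_nonpos_of_nonneg_of_nonpos (by positivity) hA)
    rw [integral_mul_smul, div_mul_cancel₀ _ hneg.ne'] at h1
    linarith
  have hall : ∀ Y : LInf P, ∫ ω, Z ω * Y ω ∂P ≤ ρ Y * ∫ ω, Z ω ∂P := by
    intro Y
    have h1 := hcone (Y - Lp.const ∞ P (ρ Y)) (by rw [h.map_sub_const, sub_self])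
    rw [integral_mul_sub hZ, integral_mul_const] at h1
    linarith
  have hm : 0 < ∫ ω, Z ω ∂P := by
    have h1 := hcone (X₀ - Lp.const ∞ P ‖X₀‖) (by
      rw [h.map_sub_const]
      have := h.monotonicity _ _ (le_const_norm X₀)
      rw [h.map_const] at this
      linarith)
    rw [integral_mul_sub hZ, integral_mul_const] at h1
    exact pos_of_mul_pos_right (by linarith : 0 < ‖X₀‖ * ∫ ω, Z ω ∂P) (norm_nonneg _)
  set m := ∫ ω, Z ω ∂P with hmdef
  have hscale : ∀ Y : LInf P, ∫ ω, m⁻¹ * Z ω * Y ω ∂P = m⁻¹ * ∫ ω, Z ω * Y ω ∂P := by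
    intro Y
    simp only [mul_assoc, integral_const_mul]
  refine ⟨fun ω => m⁻¹ * Z ω, ⟨hZ.const_mul _, fun Y => ?_⟩, ?_⟩
  · rw [hscale, inv_mul_le_iff₀ hm, mul_comm m]
    exact hall Y
  · rw [hscale, lt_inv_mul_iff₀ hm]
    rw [hX₀, integral_mul_sub hZ, integral_mul_const] at hX₀pos
    linarith

end Representation

/-! ### Absolutely continuous signed measures and their densities -/

section Densities
variable {Ω : Type*} {G mΩ : MeasurableSpace Ω} {P : Measure Ω} {hG : G ≤ mΩ}

lemma measurable_density (μ : acSigned P hG) : Measurable[G] (density μ) :=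
  SignedMeasure.measurable_rnDeriv _ _

lemma integrable_density (μ : acSigned P hG) : Integrable (density μ) P :=
  integrable_of_integrable_trim hG (SignedMeasure.integrable_rnDeriv _ _)

lemma add_mem_LInfSub {X Y : LInf P} (hX : X ∈ LInfSub G P) (hY : Y ∈ LInfSub G P) :
    X + Y ∈ LInfSub G P :=
  (AEStronglyMeasurable.add hX hY).congr (Lp.coeFn_add X Y).symm

lemma smul_mem_LInfSub {X : LInf P} (hX : X ∈ LInfSub G P) (c : ℝ) : c • X ∈ LInfSub G P :=
  (AEStronglyMeasurable.const_smul hX c).congr (Lp.coeFn_smul c X).symm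

lemma convex_acProb : Convex ℝ (acProb P hG) := by
  intro μ hμ ν hν a b ha hb hab
  constructor
  · intro A hA
    change 0 ≤ a * _ + b * _
    have := hμ.1 A hA
    have := hν.1 A hA
    positivity
  · change a * _ + b * _ = _
    rw [hμ.2, hν.2]; linarith

variable [IsFiniteMeasure P]

lemma coe_apply_eq_setIntegral_density (μ : acSigned P hG) {A : Set Ω} (hA : MeasurableSet[G] A) :
    (μ : @SignedMeasure Ω G) A = ∫ ω in A, density μ ω ∂P := by
  have h1 := SignedMeasure.withDensityᵥ_rnDeriv_eq (μ : @SignedMeasure Ω G) (P.trim hG) μ.2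
  conv_lhs => rw [← h1]
  rw [withDensityᵥ_apply (SignedMeasure.integrable_rnDeriv _ _) hA]
  exact (setIntegral_trim hG (measurable_density μ).stronglyMeasurable hA).symm

lemma density_ae_eq_of_setIntegral_eq (μ : acSigned P hG) {Z : Ω → ℝ} (hZ : Integrable Z P)
    (hZm : AEStronglyMeasurable[G] Z P)
    (h : ∀ A, MeasurableSet[G] A → (μ : @SignedMeasure Ω G) A = ∫ ω in A, Z ω ∂P) :
    density μ =ᵐ[P] Z := by
  refine ae_eq_of_forall_setIntegral_eq_of_sigmaFinite' hG
    (fun A _ _ => (integrable_density μ).integrableOn) (fun A _ _ => hZ.integrableOn)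
    (fun A hA _ => ?_) (measurable_density μ).stronglyMeasurable.aestronglyMeasurable hZm
  rw [← coe_apply_eq_setIntegral_density μ hA, h A hA]

lemma density_comb (μ ν : acSigned P hG) (a b : ℝ) :
    density (a • μ + b • ν) =ᵐ[P] fun ω => a * density μ ω + b * density ν ω := by
  refine density_ae_eq_of_setIntegral_eq _
    (((integrable_density μ).const_mul a).add ((integrable_density ν).const_mul b))
    ((((measurable_density μ).const_mul a).add
      ((measurable_density ν).const_mul b)).stronglyMeasurable.aestronglyMeasurable) fun A hA => ?_
  rw [integral_add ((integrable_density μ).const_mul a).integrableOn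
    ((integrable_density ν).const_mul b).integrableOn, integral_const_mul, integral_const_mul,
    ← coe_apply_eq_setIntegral_density μ hA, ← coe_apply_eq_setIntegral_density ν hA]
  rfl

lemma expect_comb (μ ν : acSigned P hG) (a b : ℝ) (X : LInf P) :
    expect (a • μ + b • ν) X = a * expect μ X + b * expect ν X := by
  unfold expect
  rw [← integral_const_mul, ← integral_const_mul, ← integral_add
    ((integrable_mul_LInf (integrable_density μ) X).const_mul a)
    ((integrable_mul_LInf (integrable_density ν) X).const_mul b)]
  refine integral_congr_ae ?_
  filter_upwards [density_comb μ ν a b] with ω h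
  rw [h]; ring

lemma exists_density_ae_eq (hG : G ≤ mΩ) {Z : Ω → ℝ} (hZ : Integrable Z P)
    (hZm : AEStronglyMeasurable[G] Z P) : ∃ μ : acSigned P hG, density μ =ᵐ[P] Z := by
  have hint : Integrable (hZm.mk Z) P := hZ.congr hZm.ae_eq_mk
  have hint' : Integrable (hZm.mk Z) (P.trim hG) := hint.trim hG hZm.stronglyMeasurable_mk
  refine ⟨⟨(P.trim hG).withDensityᵥ (hZm.mk Z),
    Measure.withDensityᵥ_absolutelyContinuous _ _⟩, ?_⟩
  refine density_ae_eq_of_setIntegral_eq _ hZ hZm fun A hA => ?_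
  rw [integral_congr_ae (ae_restrict_of_ae hZm.ae_eq_mk),
    setIntegral_trim hG hZm.stronglyMeasurable_mk hA]
  exact withDensityᵥ_apply hint' hA

lemma const_mem_LInfSub (c : ℝ) : (Lp.const ∞ P c : LInf P) ∈ LInfSub G P :=
  (@stronglyMeasurable_const _ _ G _ c).aestronglyMeasurable.congr
    (Lp.coeFn_const (p := ∞) (μ := P) c).symm

lemma exists_indicator_mem_LInfSub (hG : G ≤ mΩ) {A : Set Ω} (hA : MeasurableSet[G] A) :
    ∃ X ∈ LInfSub G P, X =ᵐ[P] A.indicator fun _ => (1 : ℝ) :=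
  have h := indicatorConstLp_coeFn (p := ∞) (μ := P) (hs := hG A hA) (hμs := measure_ne_top P A)
    (c := (1 : ℝ))
  ⟨indicatorConstLp ∞ (hG A hA) (measure_ne_top P A) (1 : ℝ),
    ((@stronglyMeasurable_const _ _ G _ (1 : ℝ)).indicator hA).aestronglyMeasurable.congr h.symm, h⟩

lemma coe_apply_eq_expect (μ : acSigned P hG) {A : Set Ω} (hA : MeasurableSet[G] A) {X : LInf P}
    (hX : X =ᵐ[P] A.indicator fun _ => (1 : ℝ)) : (μ : @SignedMeasure Ω G) A = expect μ X := by
  rw [coe_apply_eq_setIntegral_density μ hA, ← integral_indicator (hG A hA)]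
  refine integral_congr_ae ?_
  filter_upwards [hX] with ω h
  rw [h]
  by_cases hω : ω ∈ A <;> simp [hω]

lemma expect_const (μ : acSigned P hG) (c : ℝ) :
    expect μ (Lp.const ∞ P c) = c * (μ : @SignedMeasure Ω G) Set.univ := by
  rw [coe_apply_eq_setIntegral_density μ MeasurableSet.univ, Measure.restrict_univ]
  exact integral_mul_const c

/-- Integrating a density against `G`-measurable bounded random variables only depends on its
conditional expectation. -/
lemma integral_condExp_mul (hG : G ≤ mΩ) {Z : Ω → ℝ} (hZ : Integrable Z P) {X : LInf P}
    (hX : X ∈ LInfSub G P) : ∫ ω, (P[Z | G]) ω * X ω ∂P = ∫ ω, Z ω * X ω ∂P := by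
  have h1 := condExp_mul_of_aestronglyMeasurable_right (m := G) hX (integrable_mul_LInf hZ X) hZ
  rw [← integral_condExp hG (f := fun ω => Z ω * X ω)]
  exact integral_congr_ae h1.symm

end Densities

/-! ### Representation by coherent adjustments -/

section Adjustments
variable {Ω : Type*} {G mΩ : MeasurableSpace Ω} {P : Measure Ω} {hG : G ≤ mΩ}
  {R : Set (acSigned P hG)} {τ : R → LInf P → ℝ} {ρ : LInf P → ℝ}

lemma IsCoherentAdjustment.map_zero {μ : acSigned P hG} {τ : LInf P → ℝ}
    (h : IsCoherentAdjustment μ τ) : τ 0 = 0 := by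
  simpa using h.positive_homogeneity 0 0 le_rfl

lemma IsCoherentAdjustment.eq_zero {μ : acSigned P hG} {τ : LInf P → ℝ}
    (h : IsCoherentAdjustment μ τ) {X : LInf P} (hX : X ∈ LInfSub G P) : τ X = 0 := by
  have := h.invariance 0 X hX
  rwa [zero_add, h.map_zero] at this

/-- On `L^∞(G)` the adjustments vanish, and `ρ` is the support function of `R`. -/
lemma Represents.isLUB_expect (hρ : Represents R τ ρ) (hτ : IsCAAssignment R τ) {X : LInf P}
    (hX : X ∈ LInfSub G P) :
    IsLUB (Set.range fun μ : R => expect (μ : acSigned P hG) X) (ρ X) := by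
  have h := hρ X
  simpa only [(hτ _).1.eq_zero hX, add_zero] using h

theorem Represents.isFatou (hρ : Represents R τ ρ) (hτ : IsCAAssignment R τ) : IsFatou ρ :=
  isFatou_of_isLUB (g := fun (μ : R) X => expect (μ : acSigned P hG) X + τ μ X)
    (fun μ => (hτ μ).2.add_integral_mul (integrable_density (μ : acSigned P hG))) hρ

/-- The restrictions to `G` of the probability measures dominated by `ρ`. -/
def restrictedMeasures (P : Measure Ω) (hG : G ≤ mΩ) (ρ : LInf P → ℝ) : Set (acSigned P hG) :=
  {μ ∈ acProb P hG | ∃ Z ∈ dominatedDensities ρ, ∀ X ∈ LInfSub G P,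
    expect μ X = ∫ ω, Z ω * X ω ∂P}

/-- The densities dominated by `ρ` whose restriction to `G` is `μ`. -/
def fiber (ρ : LInf P → ℝ) (μ : acSigned P hG) : Set (Ω → ℝ) :=
  {Z ∈ dominatedDensities ρ | ∀ X ∈ LInfSub G P, expect μ X = ∫ ω, Z ω * X ω ∂P}

/-- The largest expectation under probability measures dominated by `ρ` that extend `μ`. -/
noncomputable def fiberSup (ρ : LInf P → ℝ) (μ : acSigned P hG) (X : LInf P) : ℝ :=
  sSup ((fun Z : Ω → ℝ => ∫ ω, Z ω * X ω ∂P) '' fiber ρ μ)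

lemma isLUB_fiberSup {μ : acSigned P hG} (hμ : (fiber ρ μ).Nonempty) (X : LInf P) :
    IsLUB ((fun Z : Ω → ℝ => ∫ ω, Z ω * X ω ∂P) '' fiber ρ μ) (fiberSup ρ μ X) :=
  isLUB_csSup (hμ.image _) ⟨ρ X, by rintro _ ⟨Z, hZ, rfl⟩; exact hZ.1.2 X⟩

lemma isFatou_fiberSup_sub {μ : acSigned P hG} (hμ : (fiber ρ μ).Nonempty) :
    IsFatou fun X => fiberSup ρ μ X - expect μ X := by
  have hF : IsFatou (fiberSup ρ μ) := by
    refine isFatou_of_isLUB (ι := fiber ρ μ) (g := fun Z X => ∫ ω, (Z : Ω → ℝ) ω * X ω ∂P)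
      (fun Z => isFatou_integral_mul Z.2.1.1) fun X => ?_
    have := isLUB_fiberSup hμ X
    rwa [Set.image_eq_range] at this
  have := hF.add_integral_mul (integrable_density μ).neg
  convert this using 2 with X
  simp only [Pi.neg_apply, neg_mul, integral_neg]
  unfold expect
  ring

variable [IsFiniteMeasure P]

theorem Represents.isCoherent (hρ : Represents R τ ρ) (hR : R ⊆ acProb P hG)
    (hτ : IsCAAssignment R τ) : IsCoherent ρ where
  cash_invariance := fun X c => by
    have hμ : ∀ μ : R, expect (μ : acSigned P hG) (X + Lp.const ∞ P c)
        + τ μ (X + Lp.const ∞ P c) = expect (μ : acSigned P hG) X + τ μ X + c := fun μ => by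
      rw [(hτ μ).1.invariance _ _ (const_mem_LInfSub c)]
      have h1 : expect (μ : acSigned P hG) (X + Lp.const ∞ P c)
          = expect (μ : acSigned P hG) X + expect (μ : acSigned P hG) (Lp.const ∞ P c) :=
        integral_mul_add (integrable_density _) _ _
      rw [h1, expect_const, (hR μ.2).2]
      ring
    refine le_antisymm ((hρ _).2 ?_) ?_
    · rintro _ ⟨μ, rfl⟩
      simp only [hμ]
      have := (hρ X).1 ⟨μ, rfl⟩
      simp only at this
      linarith
    · rw [← le_sub_iff_add_le]
      refine (hρ _).2 ?_
      rintro _ ⟨μ, rfl⟩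
      have := (hρ (X + Lp.const ∞ P c)).1 ⟨μ, rfl⟩
      simp only [hμ] at this
      linarith
  monotonicity := fun X Y hXY => by
    refine (hρ X).2 ?_
    rintro _ ⟨μ, rfl⟩
    exact ((hτ μ).1.monotonicity X Y hXY).trans ((hρ Y).1 ⟨μ, rfl⟩)
  convexity := fun X Y l hl hl' => by
    refine (hρ _).2 ?_
    rintro _ ⟨μ, rfl⟩
    have h1 : expect (μ : acSigned P hG) (l • X + (1 - l) • Y)
        = l * expect (μ : acSigned P hG) X + (1 - l) * expect (μ : acSigned P hG) Y := by
      unfold expect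
      rw [integral_mul_add (integrable_density _), integral_mul_smul, integral_mul_smul]
    have h2 := (hτ μ).1.convexity X Y l hl hl'
    have h3 := mul_le_mul_of_nonneg_left ((hρ X).1 ⟨μ, rfl⟩) hl
    have h4 := mul_le_mul_of_nonneg_left ((hρ Y).1 ⟨μ, rfl⟩) (sub_nonneg.2 hl')
    simp only [h1]
    simp only at h3 h4
    linarith
  positive_homogeneity := fun X l hl => by
    have hμ : ∀ μ : R, expect (μ : acSigned P hG) (l • X) + τ μ (l • X)
        = l * (expect (μ : acSigned P hG) X + τ μ X) := fun μ => by
      rw [(hτ μ).1.positive_homogeneity X l hl, mul_add]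
      congr 1
      exact integral_mul_smul l X
    have h1 := hρ (l • X)
    simp only [hμ] at h1
    refine h1.unique ?_
    have h2 := (hρ X).mul_left hl
    rwa [← Set.range_comp] at h2

lemma convex_restrictedMeasures : Convex ℝ (restrictedMeasures P hG ρ) := by
  rintro μ ⟨hμ, Z, hZ, hμZ⟩ ν ⟨hν, W, hW, hνW⟩ a b ha hb hab
  have hint : ∀ X : LInf P, ∫ ω, (a * Z ω + b * W ω) * X ω ∂P
      = a * ∫ ω, Z ω * X ω ∂P + b * ∫ ω, W ω * X ω ∂P := fun X => by
    rw [← integral_const_mul, ← integral_const_mul,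
      ← integral_add ((integrable_mul_LInf hZ.1 X).const_mul a)
        ((integrable_mul_LInf hW.1 X).const_mul b)]
    congr 1 with ω
    ring
  refine ⟨convex_acProb hμ hν ha hb hab, fun ω => a * Z ω + b * W ω,
    ⟨(hZ.1.const_mul a).add (hW.1.const_mul b), fun X => ?_⟩, fun X hX => ?_⟩
  · rw [hint]
    have h1 := mul_le_mul_of_nonneg_left (hZ.2 X) ha
    have h2 := mul_le_mul_of_nonneg_left (hW.2 X) hb
    have h3 : ρ X = a * ρ X + b * ρ X := by rw [← add_mul, hab, one_mul]
    linarith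
  · rw [hint, expect_comb, hμZ X hX, hνW X hX]

lemma IsCoherent.isCoherentAdjustment_fiberSup (h : IsCoherent ρ) {μ : acSigned P hG}
    (hμ : (fiber ρ μ).Nonempty) :
    IsCoherentAdjustment μ fun X => fiberSup ρ μ X - expect μ X := by
  have hlub := fun X => isLUB_fiberSup hμ X
  have hle : ∀ {X : LInf P} {Z}, Z ∈ fiber ρ μ → ∫ ω, Z ω * X ω ∂P ≤ fiberSup ρ μ X :=
    fun hZ => (hlub _).1 ⟨_, hZ, rfl⟩
  refine ⟨fun X Y hY => ?_, fun X Y hXY => ?_, fun X Y l hl hl' => ?_, fun X l hl => ?_⟩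
  · have h1 : expect μ (X + Y) = expect μ X + expect μ Y :=
      integral_mul_add (integrable_density _) _ _
    have h2 : ∀ Z ∈ fiber ρ μ, ∫ ω, Z ω * (X + Y) ω ∂P = ∫ ω, Z ω * X ω ∂P + expect μ Y :=
      fun Z hZ => by rw [integral_mul_add hZ.1.1, hZ.2 Y hY]
    have h3 : fiberSup ρ μ (X + Y) = fiberSup ρ μ X + expect μ Y := by
      refine le_antisymm ((hlub _).2 ?_) ?_
      · rintro _ ⟨Z, hZ, rfl⟩
        simp only [h2 Z hZ]
        linarith [hle (X := X) hZ]
      · rw [← le_sub_iff_add_le]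
        refine (hlub _).2 ?_
        rintro _ ⟨Z, hZ, rfl⟩
        have := hle (X := X + Y) hZ
        rw [h2 Z hZ] at this
        simp only
        linarith
    simp only [h1, h3]
    ring
  · rw [add_sub_cancel, add_sub_cancel]
    refine (hlub X).2 ?_
    rintro _ ⟨Z, hZ, rfl⟩
    exact (h.integral_mul_mono hZ.1 hXY).trans (hle hZ)
  · have h1 : expect μ (l • X + (1 - l) • Y) = l * expect μ X + (1 - l) * expect μ Y := by
      unfold expect
      rw [integral_mul_add (integrable_density _), integral_mul_smul, integral_mul_smul]
    have h2 : fiberSup ρ μ (l • X + (1 - l) • Y)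
        ≤ l * fiberSup ρ μ X + (1 - l) * fiberSup ρ μ Y := by
      refine (hlub _).2 ?_
      rintro _ ⟨Z, hZ, rfl⟩
      simp only [integral_mul_add hZ.1.1, integral_mul_smul]
      exact add_le_add (mul_le_mul_of_nonneg_left (hle hZ) hl)
        (mul_le_mul_of_nonneg_left (hle hZ) (sub_nonneg.2 hl'))
    simp only [h1]
    linarith
  · have h1 : expect μ (l • X) = l * expect μ X := integral_mul_smul l X
    have h2 : fiberSup ρ μ (l • X) = l * fiberSup ρ μ X := by
      unfold fiberSup
      simp only [integral_mul_smul]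
      rw [← smul_eq_mul, ← Real.sSup_smul_of_nonneg hl, ← Set.image_smul, Set.image_image]
      rfl
    simp only [h1, h2]
    ring

lemma IsCoherent.exists_mem_fiber (h : IsCoherent ρ) (hG : G ≤ mΩ) {Z : Ω → ℝ}
    (hZ : Z ∈ dominatedDensities ρ) : ∃ μ ∈ restrictedMeasures P hG ρ, Z ∈ fiber ρ μ := by
  obtain ⟨μ, hμ⟩ := exists_density_ae_eq hG (integrable_condExp (m := G) (μ := P) (f := Z))
    stronglyMeasurable_condExp.aestronglyMeasurable
  have hexp : ∀ X ∈ LInfSub G P, expect μ X = ∫ ω, Z ω * X ω ∂P := fun X hX => by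
    rw [← integral_condExp_mul hG hZ.1 hX]
    refine integral_congr_ae ?_
    filter_upwards [hμ] with ω h
    rw [h]
  refine ⟨μ, ⟨⟨fun A hA => ?_, ?_⟩, Z, hZ, hexp⟩, hZ, hexp⟩
  · obtain ⟨X, hX, hXA⟩ := exists_indicator_mem_LInfSub (P := P) hG hA
    rw [coe_apply_eq_expect μ hA hXA, hexp X hX]
    have h0 : (0 : LInf P) ≤ X := by
      rw [← Lp.coeFn_le]
      filter_upwards [hXA, Lp.coeFn_zero ℝ ∞ P] with ω h1 h2
      rw [h1, h2]
      exact Set.indicator_nonneg (fun _ _ => zero_le_one) ω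
    have := h.integral_mul_mono hZ h0
    have hzero : ∫ ω, Z ω * (0 : LInf P) ω ∂P = 0 := (integralMulCLM hZ.1).map_zero
    rwa [hzero] at this
  · have h1 := expect_const μ 1
    rw [one_mul] at h1
    rw [← h1, hexp _ (const_mem_LInfSub 1), integral_mul_const, one_mul, h.integral_eq_one hZ]

/-- A Fatou coherent risk measure is represented by the restrictions to `G` of the probability
measures it dominates, the adjustment of `μ` being the supremum over the extensions of `μ`. -/
theorem IsCoherent.exists_represents (h : IsCoherent ρ) (hF : IsFatou ρ) (hG : G ≤ mΩ) :
    ∃ R : Set (acSigned P hG), R ⊆ acProb P hG ∧ Convex ℝ R ∧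
      ∃ τ : R → LInf P → ℝ, IsCAAssignment R τ ∧ Represents R τ ρ := by
  have hne : ∀ μ : restrictedMeasures P hG ρ, (fiber ρ (μ : acSigned P hG)).Nonempty := by
    rintro ⟨μ, -, Z, hZ, hμ⟩
    exact ⟨Z, hZ, hμ⟩
  refine ⟨restrictedMeasures P hG ρ, fun μ hμ => hμ.1, convex_restrictedMeasures,
    fun μ X => fiberSup ρ (μ : acSigned P hG) X - expect (μ : acSigned P hG) X,
    fun μ => ⟨h.isCoherentAdjustment_fiberSup (hne μ), isFatou_fiberSup_sub (hne μ)⟩,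
    fun X => ⟨?_, fun u hu => ?_⟩⟩
  · rintro _ ⟨μ, rfl⟩
    simp only [add_sub_cancel]
    refine (isLUB_fiberSup (hne μ) X).2 ?_
    rintro _ ⟨Z, hZ, rfl⟩
    exact hZ.1.2 X
  · refine le_of_forall_lt fun c hc => ?_
    obtain ⟨Z, hZ, hcZ⟩ := h.exists_lt_integral_mul hF hc
    obtain ⟨μ, hμ, hZμ⟩ := h.exists_mem_fiber hG hZ
    have h1 := hu ⟨⟨μ, hμ⟩, rfl⟩
    simp only [add_sub_cancel] at h1
    exact hcZ.trans_le (((isLUB_fiberSup ⟨Z, hZμ⟩ X).1 ⟨Z, hZμ, rfl⟩).trans h1)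

end Adjustments

/-! ### The weak closure -/

section WeakClosure
variable {Ω : Type*} {G mΩ : MeasurableSpace Ω} {P : Measure Ω} {hG : G ≤ mΩ}
  {R : Set (acSigned P hG)} {μ : acSigned P hG}

lemma expect_le_of_mem_closure (hμ : μ ∈ @closure _ (weakTopology P hG) R) {X : LInf P}
    (hX : X ∈ LInfSub G P) {u : ℝ} (hu : ∀ ν ∈ R, expect ν X ≤ u) : expect μ X ≤ u := by
  let _ := weakTopology P hG
  have hcont : Continuous fun ν : acSigned P hG => expect ν X :=
    (continuous_apply (⟨X, hX⟩ : LInfSub G P)).comp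
      (continuous_induced_dom (f := fun (ν : acSigned P hG) (Y : LInfSub G P) =>
        expect ν (Y : LInf P)))
  exact closure_minimal (s := R) (t := {ν | expect ν X ≤ u}) hu
    (isClosed_le hcont continuous_const) hμ

variable [IsFiniteMeasure P]

/-- Hahn-Banach separation of a point from the weak closure of a convex set of measures. A basic
neighbourhood involves finitely many elements of `L^∞(G)`, so that separation takes place in a
finite-dimensional space. -/
lemma exists_separation_of_notMem_closure (hR : Convex ℝ R)
    (hμ : μ ∉ @closure _ (weakTopology P hG) R) :
    ∃ X ∈ LInfSub G P, ∃ u : ℝ, (∀ ν ∈ R, expect ν X < u) ∧ u < expect μ X := by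
  classical
  let ev : acSigned P hG → LInfSub G P → ℝ := fun ν X => expect ν (X : LInf P)
  have h1 : ev μ ∉ closure (ev '' R) := by
    let _ := weakTopology P hG
    have : Topology.IsInducing ev := ⟨rfl⟩
    rwa [this.closure_eq_preimage_closure_image, Set.mem_preimage] at hμ
  rw [mem_closure_iff_nhds] at h1
  push Not at h1
  obtain ⟨V, hV, hVR⟩ := h1
  rw [nhds_pi, Filter.mem_pi] at hV
  obtain ⟨I, hI, t, ht, htV⟩ := hV
  let J := hI.toFinset
  -- Only the coordinates in `J` constrain the neighbourhood `V`.
  let evJ : acSigned P hG → J → ℝ := fun ν X => expect ν (X : LInf P)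
  have hconv : Convex ℝ (evJ '' R) := by
    rintro _ ⟨ν, hν, rfl⟩ _ ⟨ν', hν', rfl⟩ a b ha hb hab
    refine ⟨a • ν + b • ν', hR hν hν' ha hb hab, ?_⟩
    ext X
    exact expect_comb ν ν' a b X
  have hnot : evJ μ ∉ closure (evJ '' R) := by
    intro hmem
    rw [mem_closure_iff_nhds] at hmem
    obtain ⟨_, hx, ν, hν, rfl⟩ := hmem (Set.pi Set.univ fun X : J => t X)
      (set_pi_mem_nhds Set.finite_univ fun X _ => ht X)
    have : ev ν ∈ V ∩ ev '' R := ⟨htV fun X hX => hx ⟨X, hI.mem_toFinset.2 hX⟩ trivial, ν, hν, rfl⟩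
    rw [hVR] at this
    exact this
  obtain ⟨f, u, hfR, hfμ⟩ := geometric_hahn_banach_closed_point hconv.closure isClosed_closure hnot
  let X : LInf P := ∑ Y : J, f (Pi.single Y 1) • ((Y : LInfSub G P) : LInf P)
  have hX : X ∈ LInfSub G P := by
    refine Finset.sum_induction _ (· ∈ LInfSub G P) (fun _ _ => add_mem_LInfSub) ?_
      fun Y _ => smul_mem_LInfSub Y.1.2 _
    simpa using const_mem_LInfSub (G := G) (P := P) 0
  have hexp : ∀ ν : acSigned P hG, expect ν X = f (evJ ν) := by
    intro ν
    have h2 : expect ν X = ∑ Y : J, f (Pi.single Y 1) * expect ν ((Y : LInfSub G P) : LInf P) := by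
      change integralMulCLM (integrable_density ν) X = _
      simp only [X, map_sum, map_smul, smul_eq_mul]
      rfl
    have h3 : evJ ν = ∑ Y : J, evJ ν Y • Pi.single Y (1 : ℝ) := by
      ext Y
      simp [Finset.sum_apply, Pi.single_apply]
    rw [h2, h3, map_sum]
    refine Finset.sum_congr rfl fun Y _ => ?_
    rw [map_smul, smul_eq_mul, mul_comm]
  refine ⟨X, hX, u, fun ν hν => ?_, ?_⟩
  · rw [hexp]
    exact hfR _ (subset_closure ⟨ν, hν, rfl⟩)
  · rwa [hexp]

end WeakClosure

/-! ### Random variables on atomless spaces -/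

section Splits
open scoped unitInterval
variable {Ω : Type*} {m : MeasurableSpace Ω} {μ : Measure Ω}

/-- Every measurable set has measurable subsets of each smaller measure. -/
def Splits (μ : Measure Ω) : Prop :=
  ∀ B, MeasurableSet B → ∀ p ≤ μ B, ∃ A ⊆ B, MeasurableSet A ∧ μ A = p

lemma Splits.cond [IsFiniteMeasure μ] (hμ : Splits μ) {B : Set Ω} (hB : MeasurableSet B)
    (h0 : μ B ≠ 0) : Splits (μ[|B]) := by
  intro C hC p hp
  rw [cond_apply hB] at hp
  have hBt : μ B ≠ ∞ := measure_ne_top μ B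
  obtain ⟨A, hAC, hA, hAp⟩ := hμ (B ∩ C) (hB.inter hC) (μ B * p) (by
    calc μ B * p ≤ μ B * ((μ B)⁻¹ * μ (B ∩ C)) := by gcongr
      _ = μ (B ∩ C) := by rw [← mul_assoc, ENNReal.mul_inv_cancel h0 hBt, one_mul])
  refine ⟨A, hAC.trans Set.inter_subset_right, hA, ?_⟩
  rw [cond_apply hB, Set.inter_eq_right.2 (hAC.trans Set.inter_subset_left), hAp, ← mul_assoc,
    ENNReal.inv_mul_cancel h0 hBt, one_mul]

lemma Splits.exists_half [IsFiniteMeasure μ] (hμ : Splits μ) {B : Set Ω} (hB : MeasurableSet B) :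
    ∃ A ⊆ B, MeasurableSet A ∧ μ.real A = μ.real B / 2 := by
  obtain ⟨A, hAB, hA, h⟩ := hμ B hB (μ B / 2) ENNReal.half_le_self
  exact ⟨A, hAB, hA, by simp [measureReal_def, h, ENNReal.toReal_div]⟩

/-- The random variables taking each of the values `0, …, 2 ^ n - 1` with equal probability. -/
def DyadicUniform (μ : Measure Ω) (n : ℕ) : Type _ :=
  {U : Ω → ℕ // Measurable U ∧ (∀ ω, U ω < 2 ^ n) ∧
    ∀ k < 2 ^ n, μ.real (U ⁻¹' {k}) = (1 / 2 : ℝ) ^ n}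

lemma Splits.exists_refine [IsFiniteMeasure μ] (hμ : Splits μ) {n : ℕ} (U : DyadicUniform μ n) :
    ∃ U' : DyadicUniform μ (n + 1), ∀ ω, U'.1 ω = 2 * U.1 ω ∨ U'.1 ω = 2 * U.1 ω + 1 := by
  classical
  obtain ⟨U, hU, hlt, hval⟩ := U
  choose A hAsub hA hAhalf using fun k : ℕ => hμ.exists_half (hU (measurableSet_singleton k))
  have hE : MeasurableSet (⋃ k, A k) := MeasurableSet.iUnion hA
  have hmemA : ∀ ω, ω ∈ ⋃ k, A k ↔ ω ∈ A (U ω) := by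
    intro ω
    refine ⟨fun h => ?_, fun h => Set.mem_iUnion.2 ⟨_, h⟩⟩
    obtain ⟨k, hk⟩ := Set.mem_iUnion.1 h
    have : U ω = k := hAsub k hk
    rwa [this]
  -- Append the binary digit that is `1` exactly on the chosen halves `A k` of the fibers of `U`.
  let U' : Ω → ℕ := fun ω => if ω ∈ ⋃ k, A k then 2 * U ω + 1 else 2 * U ω
  have hodd : ∀ k, U' ⁻¹' {2 * k + 1} = A k := by
    intro k
    ext ω
    simp only [Set.mem_preimage, Set.mem_singleton_iff, U']
    split_ifs with h
    · rw [hmemA] at h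
      constructor
      · intro h'
        have : U ω = k := by omega
        rwa [this] at h
      · intro h'
        have : U ω = k := hAsub k h'
        omega
    · constructor
      · intro h'; omega
      · intro h'; exact absurd (Set.mem_iUnion.2 ⟨k, h'⟩) h
  have heven : ∀ k, U' ⁻¹' {2 * k} = U ⁻¹' {k} \ A k := by
    intro k
    ext ω
    simp only [Set.mem_preimage, Set.mem_singleton_iff, U', Set.mem_sdiff]
    split_ifs with h
    · rw [hmemA] at h
      constructor
      · intro h'; omega
      · rintro ⟨h1, h2⟩; rw [h1] at h; exact absurd h h2
    · constructor
      · intro h'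
        exact ⟨by omega, fun h2 => h (Set.mem_iUnion.2 ⟨k, h2⟩)⟩
      · rintro ⟨h1, h2⟩; omega
  refine ⟨⟨U', Measurable.ite hE ((hU.const_mul 2).add_const 1) (hU.const_mul 2), fun ω => ?_,
    fun j hj => ?_⟩, fun ω => ?_⟩
  · have := hlt ω
    simp only [U', pow_succ]
    split_ifs <;> omega
  · rw [pow_succ] at hj
    obtain ⟨k, rfl | rfl⟩ := Nat.even_or_odd' j
    · rw [heven, measureReal_sdiff (hAsub k) (hA k), hAhalf, hval k (by omega)]; ring
    · rw [hodd, hAhalf, hval k (by omega)]; ring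
  · simp only [U']
    split_ifs <;> simp

lemma DyadicUniform.measureReal_lt [IsFiniteMeasure μ] {n : ℕ} (U : DyadicUniform μ n) {j : ℕ}
    (hj : j ≤ 2 ^ n) : μ.real {ω | U.1 ω < j} = j * (1 / 2 : ℝ) ^ n := by
  induction j with
  | zero => simp
  | succ j ih =>
    have h1 : {ω | U.1 ω < j + 1} = {ω | U.1 ω < j} ∪ U.1 ⁻¹' {j} := by
      ext ω
      simp only [Set.mem_ofPred_eq, Set.mem_union, Set.mem_preimage, Set.mem_singleton_iff]
      omega
    rw [h1, measureReal_union, ih (by omega), U.2.2.2 j (by omega)]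
    · push_cast; ring
    · rw [Set.disjoint_left]
      intro ω h2 h3
      simp only [Set.mem_ofPred_eq, Set.mem_preimage, Set.mem_singleton_iff] at h2 h3
      omega
    · exact U.2.1 (measurableSet_singleton j)

/-- An atomless probability space carries a uniformly distributed random variable, obtained from its
binary digits by successive halving. -/
lemma Splits.exists_uniform [IsProbabilityMeasure μ] (hμ : Splits μ) :
    ∃ V : Ω → I, Measurable V ∧ μ.map V = volume := by
  choose next hnext using fun n (U : DyadicUniform μ n) => hμ.exists_refine U
  let D : ∀ n, DyadicUniform μ n := fun n => Nat.rec
    ⟨fun _ => 0, measurable_const, fun _ => by simp, fun k hk => by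
      obtain rfl : k = 0 := by simpa using hk
      simp⟩ (fun n U => next n U) n
  let U : ℕ → Ω → ℕ := fun n => (D n).1
  have hU : ∀ n ω, U (n + 1) ω = 2 * U n ω ∨ U (n + 1) ω = 2 * U n ω + 1 := fun n => hnext n (D n)
  let v : ℕ → Ω → ℝ := fun n ω => U n ω * (1 / 2 : ℝ) ^ n
  have hpow : ∀ n : ℕ, (0 : ℝ) < (1 / 2 : ℝ) ^ n := fun n => by positivity
  have hmono : ∀ ω, Monotone fun n => v n ω := fun ω => monotone_nat_of_le_succ fun n => by
    have := hpow n
    simp only [v, pow_succ]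
    rcases hU n ω with h | h <;> rw [h] <;> push_cast <;> nlinarith
  have hanti : ∀ ω, Antitone fun n => v n ω + (1 / 2 : ℝ) ^ n := fun ω =>
    antitone_nat_of_succ_le fun n => by
      have := hpow n
      simp only [v, pow_succ]
      rcases hU n ω with h | h <;> rw [h] <;> push_cast <;> nlinarith
  have hbound : ∀ ω m n, v m ω ≤ v n ω + (1 / 2 : ℝ) ^ n := fun ω m n => by
    rcases le_total m n with h | h
    · exact (hmono ω h).trans (by linarith [hpow n])
    · have h1 := hanti ω h
      simp only at h1
      linarith [hpow m]
  have hbdd : ∀ ω, BddAbove (Set.range fun n => v n ω) := fun ω =>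
    ⟨v 0 ω + (1 / 2 : ℝ) ^ 0, by rintro _ ⟨m, rfl⟩; exact hbound ω m 0⟩
  let w : Ω → ℝ := fun ω => ⨆ n, v n ω
  have hlow : ∀ n ω, v n ω ≤ w ω := fun n ω => le_ciSup (hbdd ω) n
  have hup : ∀ n ω, w ω ≤ v n ω + (1 / 2 : ℝ) ^ n := fun n ω => ciSup_le fun m => hbound ω m n
  have hwm : Measurable w := measurable_of_tendsto_metrizable (f := v)
    (fun n => (measurable_from_nat.comp (D n).2.1).mul_const _)
    (tendsto_pi_nhds.2 fun ω => tendsto_atTop_ciSup (hmono ω) (hbdd ω))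
  have hU0 : ∀ ω, U 0 ω = 0 := fun _ => rfl
  have hw0 : ∀ ω, 0 ≤ w ω := fun ω => by
    have := hlow 0 ω
    simpa [v, hU0] using this
  have hw1 : ∀ ω, w ω ≤ 1 := fun ω => by
    have := hup 0 ω
    simpa [v, hU0] using this
  have hcdf : ∀ t : ℝ, 0 ≤ t → t ≤ 1 → μ.real {ω | w ω ≤ t} = t := by
    intro t ht0 ht1
    have hest : ∀ n : ℕ, |μ.real {ω | w ω ≤ t} - t| ≤ (1 / 2 : ℝ) ^ n := by
      intro n
      set k := ⌊t * 2 ^ n⌋₊ with hk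
      have hk1 : (k : ℝ) ≤ t * 2 ^ n := Nat.floor_le (by positivity)
      have hk2 : t * 2 ^ n < k + 1 := Nat.lt_floor_add_one _
      have h2 : (2 : ℝ) ^ n * (1 / 2 : ℝ) ^ n = 1 := by rw [← mul_pow]; norm_num
      have hk1' : k * (1 / 2 : ℝ) ^ n ≤ t := by
        have := mul_le_mul_of_nonneg_right hk1 (hpow n).le
        rwa [mul_assoc, h2, mul_one] at this
      have hk2' : t < (k + 1) * (1 / 2 : ℝ) ^ n := by
        have := mul_lt_mul_of_pos_right hk2 (hpow n)
        rwa [mul_assoc, h2, mul_one] at this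
      have hkle : k ≤ 2 ^ n := by
        have : (k : ℝ) ≤ 2 ^ n := hk1.trans (by nlinarith [(by positivity : (0 : ℝ) < 2 ^ n)])
        exact_mod_cast this
      have hsub1 : {ω | U n ω < k} ⊆ {ω | w ω ≤ t} := fun ω hω => by
        refine (hup n ω).trans (le_trans ?_ hk1')
        have : ((U n ω : ℝ) + 1) ≤ k := by exact_mod_cast hω
        have := mul_le_mul_of_nonneg_right this (hpow n).le
        simp only [v]
        linarith
      have hsub2 : {ω | w ω ≤ t} ⊆ {ω | U n ω < k + 1} := fun ω hω => by
        have h3 : v n ω < (k + 1) * (1 / 2 : ℝ) ^ n := ((hlow n ω).trans hω).trans_lt hk2'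
        have h4 : (U n ω : ℝ) < k + 1 := lt_of_mul_lt_mul_right h3 (hpow n).le
        exact_mod_cast h4
      have h5 : k * (1 / 2 : ℝ) ^ n ≤ μ.real {ω | w ω ≤ t} := by
        rw [← (D n).measureReal_lt hkle]
        exact measureReal_mono hsub1
      have h6 : μ.real {ω | w ω ≤ t} ≤ (k + 1) * (1 / 2 : ℝ) ^ n := by
        rcases hkle.lt_or_eq with hlt | heq
        · have := (D n).measureReal_lt (j := k + 1) hlt
          push_cast at this
          rw [← this]
          exact measureReal_mono hsub2
        · refine measureReal_le_one.trans ?_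
          have : (k : ℝ) = 2 ^ n := by exact_mod_cast heq
          rw [this, add_mul, h2]
          linarith [hpow n]
      rw [abs_le]
      constructor <;> linarith
    have hlim : Tendsto (fun n : ℕ => (1 / 2 : ℝ) ^ n) atTop (𝓝 0) :=
      tendsto_pow_atTop_nhds_zero_of_lt_one (by norm_num) (by norm_num)
    have := abs_nonpos_iff.1 (ge_of_tendsto' hlim hest)
    linarith
  have hwI : ∀ ω, w ω ∈ Set.Icc (0 : ℝ) 1 := fun ω => ⟨hw0 ω, hw1 ω⟩
  let V : Ω → I := fun ω => ⟨w ω, hwI ω⟩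
  have hV : Measurable V := hwm.subtype_mk
  refine ⟨V, hV, ?_⟩
  have : IsProbabilityMeasure (μ.map V) := Measure.isProbabilityMeasure_map hV.aemeasurable
  refine Measure.ext_of_Iic _ _ fun x => ?_
  rw [Measure.map_apply hV measurableSet_Iic, unitInterval.volume_Iic,
    ← hcdf x x.2.1 x.2.2, ofReal_measureReal]
  rfl

/-- An atomless probability space carries random variables with every distribution. -/
lemma Splits.exists_map_eq [IsProbabilityMeasure μ] (hμ : Splits μ) (ν : Measure ℝ)
    [IsProbabilityMeasure ν] : ∃ W : Ω → ℝ, Measurable W ∧ μ.map W = ν := by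
  obtain ⟨V, hV, hVmap⟩ := hμ.exists_uniform
  obtain ⟨f, hf, hfmap⟩ := Measure.exists_measurable_map_eq ν
  exact ⟨f ∘ V, hf.comp hV, by rw [← Measure.map_map hf hV, hVmap, hfmap]⟩

lemma measure_eq_tsum_inter_fiber {S : Ω → ℤ} (hS : Measurable S) {A : Set Ω}
    (hA : MeasurableSet A) : μ A = ∑' k, μ (S ⁻¹' {k} ∩ A) := by
  rw [← measure_iUnion]
  · congr 1
    ext ω
    simp
  · intro i j hij
    rw [Function.onFun, Set.disjoint_left]
    rintro ω ⟨h1, -⟩ ⟨h2, -⟩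
    exact hij (h1.symm.trans h2)
  · exact fun k => (hS (measurableSet_singleton k)).inter hA

/-- If `S` and `T` are discrete with the same distribution, then on an atomless space each joint
distribution of `S` with a further random variable `W` is also attained by `T` with some `W'`:
on each fiber of `T` choose `W'` with the conditional distribution of `W`. -/
lemma Splits.exists_joint_map_eq [IsProbabilityMeasure μ] (hμ : Splits μ) {S T : Ω → ℤ}
    (hS : Measurable S) (hT : Measurable T) (hST : μ.map S = μ.map T) {W : Ω → ℝ}
    (hW : Measurable W) : ∃ W' : Ω → ℝ, Measurable W' ∧
      μ.map (fun ω => (T ω, W' ω)) = μ.map (fun ω => (S ω, W ω)) := by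
  have hmeas : ∀ k, μ (S ⁻¹' {k}) = μ (T ⁻¹' {k}) := fun k => by
    rw [← Measure.map_apply hS (measurableSet_singleton k), hST,
      Measure.map_apply hT (measurableSet_singleton k)]
  have hex : ∀ k, ∃ W' : Ω → ℝ, Measurable W' ∧ ∀ E : Set ℝ, MeasurableSet E →
      μ (T ⁻¹' {k} ∩ W' ⁻¹' E) = μ (S ⁻¹' {k} ∩ W ⁻¹' E) := by
    intro k
    have hSk := hS (measurableSet_singleton k)
    have hTk := hT (measurableSet_singleton k)
    by_cases h0 : μ (T ⁻¹' {k}) = 0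
    · refine ⟨0, measurable_const, fun E _ => ?_⟩
      rw [measure_mono_null Set.inter_subset_left h0,
        measure_mono_null Set.inter_subset_left ((hmeas k).trans h0)]
    · have h0' : μ (S ⁻¹' {k}) ≠ 0 := by rwa [hmeas k]
      have := cond_isProbabilityMeasure h0
      have := cond_isProbabilityMeasure h0'
      have : IsProbabilityMeasure ((μ[|S ⁻¹' {k}]).map W) :=
        Measure.isProbabilityMeasure_map hW.aemeasurable
      obtain ⟨W', hW', hmap⟩ := (hμ.cond hTk h0).exists_map_eq ((μ[|S ⁻¹' {k}]).map W)
      refine ⟨W', hW', fun E hE => ?_⟩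
      have h1 : (μ[|T ⁻¹' {k}]).map W' E = (μ[|S ⁻¹' {k}]).map W E := by rw [hmap]
      rw [Measure.map_apply hW' hE, Measure.map_apply hW hE] at h1
      rw [← cond_mul_eq_inter hTk, ← cond_mul_eq_inter hSk, h1, hmeas k]
  choose W' hW' hW'E using hex
  have hmW : Measurable fun ω => W' (T ω) ω :=
    (measurable_from_prod_countable_right (f := fun p : ℤ × Ω => W' p.1 p.2) hW').comp
      (hT.prodMk measurable_id)
  refine ⟨fun ω => W' (T ω) ω, hmW, Measure.ext fun E hE => ?_⟩
  rw [Measure.map_apply (hT.prodMk hmW) hE, Measure.map_apply (hS.prodMk hW) hE,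
    measure_eq_tsum_inter_fiber hT (hT.prodMk hmW hE),
    measure_eq_tsum_inter_fiber hS (hS.prodMk hW hE)]
  refine tsum_congr fun k => ?_
  have hEk : MeasurableSet (Prod.mk k ⁻¹' E) := measurable_prodMk_left hE
  rw [show T ⁻¹' {k} ∩ (fun ω => (T ω, W' (T ω) ω)) ⁻¹' E
      = T ⁻¹' {k} ∩ W' k ⁻¹' (Prod.mk k ⁻¹' E) by
    ext ω
    simp only [Set.mem_inter_iff, Set.mem_preimage, Set.mem_singleton_iff]
    refine and_congr_right fun h => ?_
    rw [h], hW'E k _ hEk]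
  congr 1
  ext ω
  simp only [Set.mem_inter_iff, Set.mem_preimage, Set.mem_singleton_iff]
  refine and_congr_right fun h => ?_
  rw [h]

end Splits

/-! ### Rearrangements -/

section Rearrangement
variable {Ω : Type*} {G mΩ : MeasurableSpace Ω} {P : Measure Ω}

lemma IsAtomless.splits_trim (hP : IsAtomless G P) (hG : G ≤ mΩ) : Splits (P.trim hG) := by
  intro B hB p hp
  rw [trim_measurableSet_eq hG hB] at hp
  have : p ∈ {p : ℝ≥0∞ | ∃ A : Set Ω, A ⊆ B ∧ MeasurableSet[G] A ∧ P A = p} := by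
    rw [hP B hB]; exact ⟨zero_le, hp⟩
  obtain ⟨A, hAB, hA, hAp⟩ := this
  exact ⟨A, hAB, hA, by rw [trim_measurableSet_eq hG hA, hAp]⟩

lemma map_trim_eq (hG : G ≤ mΩ) {β : Type*} [MeasurableSpace β] {f : Ω → β}
    (hf : Measurable[G] f) : @Measure.map Ω β G _ f (P.trim hG) = P.map f := by
  ext s hs
  rw [Measure.map_apply hf hs, Measure.map_apply (hf.mono hG le_rfl) hs,
    trim_measurableSet_eq hG (hf hs)]

lemma IsAtomless.exists_joint_map_eq [IsProbabilityMeasure P] (hP : IsAtomless G P) (hG : G ≤ mΩ)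
    {S T : Ω → ℤ} (hS : Measurable[G] S) (hT : Measurable[G] T) (hST : P.map S = P.map T)
    {W : Ω → ℝ} (hW : Measurable[G] W) : ∃ W' : Ω → ℝ, Measurable[G] W' ∧
      P.map (fun ω => (T ω, W' ω)) = P.map (fun ω => (S ω, W ω)) := by
  have : IsProbabilityMeasure (P.trim hG) := 
    ⟨by rw [trim_measurableSet_eq hG MeasurableSet.univ]; exact measure_univ⟩
  obtain ⟨W', hW', h⟩ := (hP.splits_trim hG).exists_joint_map_eq hS hT
    (by rw [map_trim_eq hG hS, map_trim_eq hG hT, hST]) hW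
  rw [map_trim_eq hG (hT.prodMk hW'), map_trim_eq hG (hS.prodMk hW)] at h
  exact ⟨W', hW', h⟩

variable [IsProbabilityMeasure P]

/-- If `S` and `T` are identically distributed and `G`-measurable, the value `E[S W]` is attained,
up to an arbitrarily small error, by `E[T W']` for some `G`-measurable `W'` distributed as `W`:
round `S` and `T` to a fine grid and copy the joint distribution of the rounding of `S` with `W`. -/
theorem exists_rearrangement (hP : IsAtomless G P) (hG : G ≤ mΩ) {S T W : Ω → ℝ}
    (hS : AEStronglyMeasurable[G] S P) (hT : AEStronglyMeasurable[G] T P)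
    (hW : AEStronglyMeasurable[G] W P) (hST : IdentDistrib S T P P) (hWint : Integrable W P)
    (hSW : Integrable (fun ω => S ω * W ω) P) {ε : ℝ} (hε : 0 < ε) :
    ∃ W' : Ω → ℝ, Measurable[G] W' ∧ IdentDistrib W W' P P ∧
      ∫ ω, S ω * W ω ∂P ≤ ∫ ω, T ω * W' ω ∂P + ε := by
  set δ : ℝ := ε / (2 * (∫ ω, |W ω| ∂P + 1)) with hδdef
  have hWnn : 0 ≤ ∫ ω, |W ω| ∂P := integral_nonneg fun _ => abs_nonneg _
  have hδ : 0 < δ := by positivity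
  -- The rounding error is at most `δ` on both sides, which costs at most `2 * δ * E|W| ≤ ε`.
  let d : ℝ → ℤ := fun x => ⌊x / δ⌋
  have hd : Measurable d := (measurable_id.div_const δ).floor
  have hdδ : ∀ x, |x - δ * d x| ≤ δ := by
    intro x
    have h1 := Int.floor_le (x / δ)
    have h2 := Int.lt_floor_add_one (x / δ)
    rw [le_div_iff₀ hδ] at h1
    rw [div_lt_iff₀ hδ] at h2
    rw [abs_le]
    constructor <;> simp only [d] <;> linarith
  have hS' := hS.stronglyMeasurable_mk.measurable
  have hT' := hT.stronglyMeasurable_mk.measurable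
  have hW' := hW.stronglyMeasurable_mk.measurable
  have hdS : Measurable[G] fun ω => d (hS.mk S ω) := hd.comp hS'
  have hdT : Measurable[G] fun ω => d (hT.mk T ω) := hd.comp hT'
  have hmapd : P.map (fun ω => d (hS.mk S ω)) = P.map (fun ω => d (hT.mk T ω)) := by
    calc P.map (fun ω => d (hS.mk S ω)) = P.map (fun ω => d (S ω)) := by
          refine Measure.map_congr ?_
          filter_upwards [hS.ae_eq_mk] with ω h
          rw [h]
      _ = P.map (fun ω => d (T ω)) := (hST.comp hd).map_eq
      _ = P.map (fun ω => d (hT.mk T ω)) := by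
          refine Measure.map_congr ?_
          filter_upwards [hT.ae_eq_mk] with ω h
          rw [h]
  obtain ⟨W', hW'm, hmap⟩ := hP.exists_joint_map_eq hG hdS hdT hmapd hW'
  have hjoint : IdentDistrib (fun ω => (d (S ω), W ω)) (fun ω => (d (T ω), W' ω)) P P := by
    have h1 : (fun ω => (d (hS.mk S ω), hW.mk W ω)) =ᵐ[P] fun ω => (d (S ω), W ω) := by
      filter_upwards [hS.ae_eq_mk, hW.ae_eq_mk] with ω h1 h2
      rw [h1, h2]
    have h2 : (fun ω => (d (hT.mk T ω), W' ω)) =ᵐ[P] fun ω => (d (T ω), W' ω) := by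
      filter_upwards [hT.ae_eq_mk] with ω h1
      rw [h1]
    have m1 := ((hdS.prodMk hW').mono hG le_rfl).aemeasurable (μ := P)
    have m2 := ((hdT.prodMk hW'm).mono hG le_rfl).aemeasurable (μ := P)
    refine ⟨m1.congr h1, m2.congr h2, ?_⟩
    rw [← Measure.map_congr h1, ← Measure.map_congr h2, hmap]
  have hWW' : IdentDistrib W W' P P := hjoint.comp measurable_snd
  have hprod : IdentDistrib (fun ω => δ * d (S ω) * W ω) (fun ω => δ * d (T ω) * W' ω) P P :=
    hjoint.comp (u := fun p : ℤ × ℝ => δ * p.1 * p.2)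
      (((measurable_of_countable _).comp measurable_fst).const_mul δ |>.mul measurable_snd)
  have hW'int : Integrable W' P := hWW'.integrable_snd hWint
  have hdiff : ∀ {A B : Ω → ℝ}, AEStronglyMeasurable A P → Integrable B P →
      Integrable (fun ω => (A ω - δ * d (A ω)) * B ω) P ∧
      |∫ ω, (A ω - δ * d (A ω)) * B ω ∂P| ≤ δ * ∫ ω, |B ω| ∂P := by
    intro A B hA hB
    have hAm : AEStronglyMeasurable (fun ω => A ω - δ * d (A ω)) P :=
      (hA.aemeasurable.sub (((measurable_of_countable (fun k : ℤ => (k : ℝ))).comp_aemeasurable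
        (hd.comp_aemeasurable hA.aemeasurable)).const_mul δ)).aestronglyMeasurable
    have hint : Integrable (fun ω => (A ω - δ * d (A ω)) * B ω) P :=
      hB.bdd_mul (c := δ) hAm (ae_of_all _ fun ω => hdδ (A ω))
    refine ⟨hint, ?_⟩
    rw [← integral_const_mul]
    refine (abs_integral_le_integral_abs).trans
      (integral_mono hint.abs (hB.abs.const_mul δ) fun ω => ?_)
    simp only [abs_mul]
    exact mul_le_mul_of_nonneg_right (hdδ (A ω)) (abs_nonneg _)
  obtain ⟨hi1, hb1⟩ := hdiff (hS.mono hG) hWint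
  obtain ⟨hi2, hb2⟩ := hdiff (hT.mono hG) hW'int
  have habs : ∫ ω, |W' ω| ∂P = ∫ ω, |W ω| ∂P :=
    (hWW'.comp (u := fun x => |x|) measurable_abs).integral_eq.symm
  have hdSW : Integrable (fun ω => δ * d (S ω) * W ω) P :=
    (hSW.sub hi1).congr (ae_of_all _ fun ω => by simp only [Pi.sub_apply]; ring)
  have hdTW : Integrable (fun ω => δ * d (T ω) * W' ω) P := hprod.integrable_snd hdSW
  have e1 : ∫ ω, S ω * W ω ∂P
      = ∫ ω, (S ω - δ * d (S ω)) * W ω ∂P + ∫ ω, δ * d (S ω) * W ω ∂P := by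
    rw [← integral_add hi1 hdSW]
    congr 1 with ω
    ring
  have e2 : ∫ ω, T ω * W' ω ∂P
      = ∫ ω, (T ω - δ * d (T ω)) * W' ω ∂P + ∫ ω, δ * d (T ω) * W' ω ∂P := by
    rw [← integral_add hi2 hdTW]
    congr 1 with ω
    ring
  refine ⟨W', hW'm, hWW', ?_⟩
  rw [habs] at hb2
  have hδε : δ * ∫ ω, |W ω| ∂P ≤ ε / 2 := by
    rw [hδdef, div_mul_eq_mul_div, div_le_div_iff₀ (by positivity) (by norm_num)]
    nlinarith
  rw [e1, e2, hprod.integral_eq]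
  have := (abs_le.1 hb1).2
  have := (abs_le.1 hb2).1
  linarith

end Rearrangement

/-! ### Law invariance -/

section LawInvariance
variable {Ω : Type*} {G mΩ : MeasurableSpace Ω} {P : Measure Ω} {hG : G ≤ mΩ}
  {R : Set (acSigned P hG)} {ρ : LInf P → ℝ}

lemma aestronglyMeasurable_density (μ : acSigned P hG) : AEStronglyMeasurable[G] (density μ) P :=
  (measurable_density μ).stronglyMeasurable.aestronglyMeasurable

variable [IsProbabilityMeasure P]

/-- If the support function of a convex set of measures is law invariant, so is the weak closure of
the set: a density outside the closure is separated from it by some `X`, and rearranging `X`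
contradicts the law invariance of the support function. -/
theorem isAlmostLawInvariant_of_isLawInvariant (hP : IsAtomless G P) (hR : Convex ℝ R)
    (hρ : ∀ X ∈ LInfSub G P, IsLUB (Set.range fun μ : R => expect (μ : acSigned P hG) X) (ρ X))
    (h : IsLawInvariant G ρ) : IsAlmostLawInvariant R := by
  rintro Z ⟨μ, hμ, hZμ⟩ - Y hYm hZY
  have hμY : IdentDistrib (density μ) Y P P :=
    (IdentDistrib.of_ae_eq (integrable_density μ).aemeasurable hZμ.symm).trans hZY
  have hYint : Integrable Y P := hμY.integrable_snd (integrable_density μ)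
  obtain ⟨ν, hν⟩ := exists_density_ae_eq hG hYint hYm
  refine ⟨ν, ?_, hν.symm⟩
  by_contra hνR
  obtain ⟨X, hX, u, hRu, hu⟩ := exists_separation_of_notMem_closure hR hνR
  have hexp : expect ν X = ∫ ω, Y ω * X ω ∂P := integral_congr_ae (by
    filter_upwards [hν] with ω h1
    rw [h1])
  obtain ⟨W', hW'm, hXW', hle⟩ := exists_rearrangement hP hG hYm (aestronglyMeasurable_density μ)
    hX hμY.symm (integrable_LInf X) (integrable_mul_LInf hYint X) (half_pos (sub_pos.2 hu))
  have hbound : ∀ᵐ ω ∂P, |W' ω| ≤ ‖X‖ :=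
    hXW'.ae_snd (measurableSet_le measurable_abs measurable_const) (ae_abs_le_norm X)
  obtain ⟨X', hX'⟩ := exists_LInf_ae_eq (hW'm.mono hG le_rfl).aestronglyMeasurable hbound
  have hX'G : X' ∈ LInfSub G P := hW'm.stronglyMeasurable.aestronglyMeasurable.congr hX'.symm
  have hXX' : IdentDistrib X X' P P :=
    hXW'.trans (IdentDistrib.of_ae_eq (hW'm.mono hG le_rfl).aemeasurable hX'.symm)
  have h1 : expect μ X' ≤ ρ X' :=
    expect_le_of_mem_closure hμ hX'G fun ν hν => (hρ X' hX'G).1 ⟨⟨ν, hν⟩, rfl⟩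
  have h2 : ρ X ≤ u := (hρ X hX).2 (by rintro _ ⟨ν, rfl⟩; exact (hRu ν ν.2).le)
  have h3 : ∫ ω, density μ ω * W' ω ∂P = expect μ X' := integral_congr_ae (by
    filter_upwards [hX'] with ω h1
    rw [h1])
  rw [← h X hX X' hX'G hXX'] at h1
  rw [h3, ← hexp] at hle
  linarith

/-- If the weak closure of a set of measures is law invariant, so is its support function: the
densities are rearranged. -/
theorem isLawInvariant_of_isAlmostLawInvariant (hP : IsAtomless G P)
    (hρ : ∀ X ∈ LInfSub G P, IsLUB (Set.range fun μ : R => expect (μ : acSigned P hG) X) (ρ X))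
    (h : IsAlmostLawInvariant R) : IsLawInvariant G ρ := by
  have key : ∀ X ∈ LInfSub G P, ∀ Y ∈ LInfSub G P, IdentDistrib X Y P P → ρ X ≤ ρ Y := by
    intro X hX Y hY hXY
    refine (hρ X hX).2 ?_
    rintro _ ⟨⟨μ, hμ⟩, rfl⟩
    refine le_of_forall_pos_le_add fun ε hε => ?_
    have hcomm : ∀ (Z : Ω → ℝ) (X : LInf P), ∫ ω, X ω * Z ω ∂P = ∫ ω, Z ω * X ω ∂P :=
      fun Z X => by simp only [mul_comm]
    obtain ⟨D, hDm, hμD, hle⟩ := exists_rearrangement hP hG hX hY (aestronglyMeasurable_density μ)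
      hXY (integrable_density μ)
      ((integrable_mul_LInf (integrable_density μ) X).congr (ae_of_all _ fun ω => mul_comm _ _)) hε
    rw [hcomm, hcomm] at hle
    have hDm' := (hDm.mono hG le_rfl).aestronglyMeasurable (μ := P)
    have hμm := (integrable_density μ).aestronglyMeasurable
    have hmkμ : AEEqFun.mk (density μ) hμm =ᵐ[P] density μ := AEEqFun.coeFn_mk _ _
    have hmkD : AEEqFun.mk D hDm' =ᵐ[P] D := AEEqFun.coeFn_mk _ _
    obtain ⟨ν, hν, hνD⟩ := h (AEEqFun.mk (density μ) hμm)
      ⟨μ, @subset_closure _ (weakTopology P hG) R μ hμ, hmkμ⟩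
      ((aestronglyMeasurable_density μ).congr hmkμ.symm) (AEEqFun.mk D hDm')
      (hDm.stronglyMeasurable.aestronglyMeasurable.congr hmkD.symm)
      ((IdentDistrib.of_ae_eq (AEEqFun.mk (density μ) hμm).aemeasurable hmkμ).trans
        (hμD.trans (IdentDistrib.of_ae_eq hDm'.aemeasurable hmkD.symm)))
    have h1 : expect ν Y ≤ ρ Y :=
      expect_le_of_mem_closure hν hY fun ν hν => (hρ Y hY).1 ⟨⟨ν, hν⟩, rfl⟩
    have h2 : ∫ ω, D ω * Y ω ∂P = expect ν Y := integral_congr_ae (by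
      filter_upwards [hmkD, hνD] with ω h1 h2
      rw [← h1, h2])
    rw [h2] at hle
    exact hle.trans (by linarith)
  exact fun X hX Y hY hXY => le_antisymm (key X hX Y hY hXY) (key Y hY X hX hXY.symm)

end LawInvariance
end PartialLaw

theorem theorem3 {Ω : Type*} {G mΩ : MeasurableSpace Ω} (P : Measure Ω)
    [IsProbabilityMeasure P] (hG : G ≤ mΩ) (hatomless : PartialLaw.IsAtomless G P)
    (ρ : PartialLaw.LInf P → ℝ) :
    ((PartialLaw.IsFatou ρ ∧ PartialLaw.IsCoherent ρ) ↔
      ∃ R : Set (PartialLaw.acSigned P hG), R ⊆ PartialLaw.acProb P hG ∧ Convex ℝ R ∧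
        ∃ τ : R → PartialLaw.LInf P → ℝ,
          PartialLaw.IsCAAssignment R τ ∧ PartialLaw.Represents R τ ρ) ∧
    (∀ R : Set (PartialLaw.acSigned P hG), R ⊆ PartialLaw.acProb P hG → Convex ℝ R →
      ∀ τ : R → PartialLaw.LInf P → ℝ,
        PartialLaw.IsCAAssignment R τ → PartialLaw.Represents R τ ρ →
          (PartialLaw.IsLawInvariant G ρ ↔ PartialLaw.IsAlmostLawInvariant R)) := by
  refine ⟨⟨fun ⟨hF, hC⟩ => hC.exists_represents hF hG, ?_⟩, fun R _ hconv τ hτ hρ => ?_⟩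
  · rintro ⟨R, hR, -, τ, hτ, hρ⟩
    exact ⟨hρ.isFatou hτ, hρ.isCoherent hR hτ⟩
  · have hlub := fun X hX => hρ.isLUB_expect hτ (X := X) hX
    exact ⟨PartialLaw.isAlmostLawInvariant_of_isLawInvariant hatomless hconv hlub,
      PartialLaw.isLawInvariant_of_isAlmostLawInvariant hatomless hlub⟩
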